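/- Let $n\ge 1$ and let $D$ be a set with $[0,1]\subseteq D\subseteq\mathbb R$ (the space of possible reports of a buyer; for instance $D=[0,1]$ or $D=\mathbb R$). A mechanism $m=(\mathbf x,\mathbf p)$ consists of a measurable allocation rule $\mathbf v\mapsto(x_1(\mathbf v),\dots,x_n(\mathbf v))$ and a measurable payment rule $\mathbf v\mapsto(p_1(\mathbf v),\dots,p_n(\mathbf v))\in\mathbb R^n$. It is called DSIC if for all $\mathbf v\in D^n$, all $i$ and all $\hat v_i\in D$: $x_i(\mathbf v)\in[0,1]$, $\;v_ix_i(\mathbf v)-p_i(\mathbf v)\ge 0$, $\;v_ix_i(\mathbf v)-p_i(\mathbf v)\ge v_ix_i(\hat v_i,\mathbf v_{-i})-p_i(\hat v_i,\mathbf v_{-i})$, and $\sum_{j}x_j(\mathbf v)\le 1$. For a DSIC mechanism $m$ and a probability distribution $\mathbf F$ on $[0,1]^n$ put $R_n(m,\mathbf F)=\mathbb E_{\mathbf v\sim\mathbf F}\big[\max_i v_i-\sum_i p_i(\mathbf v)\big]\in[0,\infty]$ (the integrand is nonnegative). Let $\mathcal F_{\rm iid}$ be the set of all product distributions $F^{\otimes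 n}$ with $F$ a probability distribution on $[0,1]$, and let $\mathcal R_n^*=\inf_{m\text{ DSIC}}\ \sup_{\mathbf F\in\mathcal F_{\rm iid}}R_n(m,\mathbf F)$. A second-price auction with reserve $p$ selects a highest bidder (ties broken by an arbitrary measurable, possibly randomized, rule); if his bid is at least $p$ he gets the item and pays the maximum of $p$ and the highest bid of the other buyers (just $p$ if $n=1$ and $p\ge 0$), and otherwise there is no sale and no payment. With a random reserve, $p$ is drawn from a given distribution independently of the bids. Then the equation $$(1-r)^{n-1}+\log r+\sum_{k=1}^{n-1}\frac{(1-r)^k}{k}=0$$ has exactly one solution $r=r_n^*$ in $(0,1/n)$, and the following hold. (a) There is a probability distribution on $[r_n^*,1]$ whose cumulative distribution function is $$\Phi_n^*(v)=\Big(\frac{v}{v-r_n^*}\Big)^{n-1}\log\frac{v}{r_n^*}-\sum_{k=1}^{n-1}\frac1k\Big(\frac{v}{v-r_n^*}\Big)^{n-1-k}\quad (r_n^*<v\le 1),\qquad \Phi_n^*(r_n^*)=0 .$$ For every tie-breaking rule, the second-price auction $m_n^*$ with random reserve drawn from $\Phi_n^*$ is DSIC and attains the minimax regret: $\sup_{\mathbf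 F\in\mathcal F_{\rm iid}}R_n(m_n^*,\mathbf F)=\mathcal R_n^*$. (b) The minimax regret is finite and equals $$\mathcal R_n^*=(1-r_n^*)^{n-1}-\int_{r_n^*}^1\Big(1-\frac{r_n^*}{v}\Big)^{n-1}dv .$$ (c) Let $\mathbf F_n^*$ be the law of $n$ i.i.d. valuations with the isorevenue distribution function $F_n^*(v)=0$ for $v<r_n^*$, $F_n^*(v)=1-r_n^*/v$ for $r_n^*\le v<1$, $F_n^*(v)=1$ for $v\ge 1$. Then $(m_n^*,\mathbf F_n^*)$ is a saddle point: $R_n(m_n^*,\mathbf F)\le R_n(m_n^*,\mathbf F_n^*)\le R_n(m,\mathbf F_n^*)$ for all $\mathbf F\in\mathcal F_{\rm iid}$ and all DSIC mechanisms $m$. -/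

import Mathlib

open MeasureTheory Set
open scoped ENNReal

noncomputable section

/-- A direct mechanism for `n` buyers: `alloc v i` is the probability that buyer `i` gets the item
and `pay v i` is the expected payment of buyer `i`, at the reported valuations `v`. -/
structure Mechanism (n : ℕ) where
  alloc : (Fin n → ℝ) → Fin n → ℝ
  pay : (Fin n → ℝ) → Fin n → ℝ

/-- Dominant strategy incentive compatible mechanisms when each buyer's valuation and report range
over `D`.  The values of the mechanism at profiles outside `D ^ n` play no role; measurability
makes expectations under a valuation distribution meaningful. -/
structure IsDSIC {n : ℕ} (D : Set ℝ) (m : Mechanism n) : Prop where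
  measurable_alloc : Measurable m.alloc
  measurable_pay : Measurable m.pay
  alloc_mem : ∀ v : Fin n → ℝ, (∀ j, v j ∈ D) → ∀ i, m.alloc v i ∈ Icc (0 : ℝ) 1
  /-- ex-post individual rationality -/
  ir : ∀ v : Fin n → ℝ, (∀ j, v j ∈ D) → ∀ i, 0 ≤ v i * m.alloc v i - m.pay v i
  /-- ex-post incentive compatibility: reporting `b` instead of `v i` does not help -/
  ic : ∀ v : Fin n → ℝ, (∀ j, v j ∈ D) → ∀ i, ∀ b ∈ D,
    v i * m.alloc (Function.update v i b) i - m.pay (Function.update v i b) i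
      ≤ v i * m.alloc v i - m.pay v i
  /-- at most one item is allocated -/
  ac : ∀ v : Fin n → ℝ, (∀ j, v j ∈ D) → ∑ i, m.alloc v i ≤ 1

/-- The regret `max v - ∑ i, p i v` of a DSIC mechanism is nonnegative at every valuation profile
in the cube, so the expected regret is a well-defined element of `[0, ∞]`. -/
theorem IsDSIC.sum_pay_le_max {n : ℕ} {D : Set ℝ} (hD : Icc (0 : ℝ) 1 ⊆ D) {m : Mechanism n}
    (hm : IsDSIC D m) (v : Fin n → ℝ) (hv : ∀ j, v j ∈ Icc (0 : ℝ) 1) :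
    0 ≤ (⨆ i, v i) - ∑ i, m.pay v i := by
  have hvD : ∀ j, v j ∈ D := fun j => hD (hv j)
  have hbdd : BddAbove (range v) := (Set.finite_range v).bddAbove
  have h0 : 0 ≤ ⨆ i, v i := Real.iSup_nonneg fun j => (hv j).1
  have h1 : ∑ i, m.pay v i ≤ ∑ i, (⨆ j, v j) * m.alloc v i := by
    refine Finset.sum_le_sum fun i _ => ?_
    have h2 := hm.ir v hvD i
    have h3 := mul_le_mul_of_nonneg_right (le_ciSup hbdd i) (hm.alloc_mem v hvD i).1
    linarith
  have h4 : (⨆ j, v j) * ∑ i, m.alloc v i ≤ (⨆ j, v j) * 1 :=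
    mul_le_mul_of_nonneg_left (hm.ac v hvD) h0
  rw [Finset.mul_sum] at h4
  linarith

/-- Expected regret `E[max v - ∑ i, p i v]` under the joint valuation distribution `P`. For the
mechanisms and distributions considered here the integrand is nonnegative `P`-almost surely, so
the expectation is taken in `[0, ∞]`. -/
def regret {n : ℕ} (m : Mechanism n) (P : Measure (Fin n → ℝ)) : ℝ≥0∞ :=
  ∫⁻ v, ENNReal.ofReal ((⨆ i, v i) - ∑ i, m.pay v i) ∂P

/-- The joint laws of `n` i.i.d. valuations with values in `[0, 1]`. -/
def iidLaws (n : ℕ) : Set (Measure (Fin n → ℝ)) :=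
  {P | ∃ F : Measure ℝ, IsProbabilityMeasure F ∧ F (Icc 0 1)ᶜ = 0 ∧
    P = Measure.pi fun _ : Fin n => F}

/-- Worst-case regret over the i.i.d. valuation distributions. -/
def worstRegret {n : ℕ} (m : Mechanism n) : ℝ≥0∞ :=
  ⨆ P ∈ iidLaws n, regret m P

/-- Minimax regret over the DSIC mechanisms with valuation space `D`. -/
def minimaxRegret (n : ℕ) (D : Set ℝ) : ℝ≥0∞ :=
  ⨅ (m : Mechanism n) (_ : IsDSIC D m), worstRegret m

/-- A (possibly randomized) rule selecting one highest bidder: `τ v i` is the probability that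
buyer `i` is selected at the bids `v`. -/
structure IsTieBreaking {n : ℕ} (τ : (Fin n → ℝ) → Fin n → ℝ) : Prop where
  measurable : Measurable τ
  nonneg : ∀ v i, 0 ≤ τ v i
  sum_eq_one : ∀ v, ∑ i, τ v i = 1
  highest : ∀ v i, τ v i ≠ 0 → ∀ j, v j ≤ v i

/-- The highest bid of the buyers other than `i` (it is `0` if there is no other buyer).
If `i` is a highest bidder this is the second highest bid. -/
def competingBid {n : ℕ} (v : Fin n → ℝ) (i : Fin n) : ℝ :=
  ⨆ j : {j : Fin n // j ≠ i}, v j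

/-- The second-price auction with reserve `p`: the selected highest bidder gets the item if his bid
is at least `p`, and then pays the maximum of the second highest bid and `p`. -/
def secondPrice {n : ℕ} (τ : (Fin n → ℝ) → Fin n → ℝ) (p : ℝ) : Mechanism n where
  alloc v i := if p ≤ v i then τ v i else 0
  pay v i := if p ≤ v i then τ v i * max (competingBid v i) p else 0

/-- The second-price auction with random reserve price drawn from `ν`. -/
def randomReserveSPA {n : ℕ} (τ : (Fin n → ℝ) → Fin n → ℝ) (ν : Measure ℝ) : Mechanism n where
  alloc v i := ∫ p, (secondPrice τ p).alloc v i ∂ν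
  pay v i := ∫ p, (secondPrice τ p).pay v i ∂ν

/-- The equation for the lower end point of the support of the reserve price. -/
def ReserveEquation (n : ℕ) (r : ℝ) : Prop :=
  (1 - r) ^ (n - 1) + Real.log r + ∑ k ∈ Finset.Icc 1 (n - 1), (1 - r) ^ k / (k : ℝ) = 0

/-- The reserve price distribution function on the real line; the closed formula is used on
`(r, 1]`, and at `v = r` its limit `0`. -/
def reserveCDF (n : ℕ) (r v : ℝ) : ℝ :=
  if v ≤ r then 0
  else if v ≤ 1 then
    (v / (v - r)) ^ (n - 1) * Real.log (v / r)
      - ∑ k ∈ Finset.Icc 1 (n - 1), 1 / (k : ℝ) * (v / (v - r)) ^ (n - 1 - k)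
  else 1

/-- The isorevenue distribution function, with an atom of mass `r` at `1`. -/
def isorevenueCDF (r v : ℝ) : ℝ :=
  if v < r then 0 else if v < 1 then 1 - r / v else 1

end

/-!
The theorem is a saddle point argument, so two inequalities suffice: the random reserve auction has
regret at most `V = saddleValue` against every i.i.d. law (`regret_randomReserveSPA_le`), and every
DSIC mechanism has regret at least `V` against the isorevenue law
(`IsDSIC.saddleValue_le_regret`). Write `n = m + 1`, `Φ` for the distribution function of the
reserve, `φ` for its density and `L q = ∑_{k > m} q ^ k / k` (`logTail`).

*The reserve law.* In the variable `q = 1 - r / t` one has `Φ t = L q / q ^ m`, and the equation for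
`r` says `Φ 1 = 1`. The estimate `L q ≤ q ^ (m + 1) / ((m + 1) (1 - q))` gives the continuity of `Φ`
at `r` and `φ ≥ 0`; the root is unique because the equation is strictly increasing on `(0, 1 / n)`.

*Upper bound.* The regret of the auction at a profile is the integral over price levels `t ∈ (0, 1]`
of `1(some value > t) (1 - t φ t) - Φ t 1(two values > t)` (`regret_eq_integral`). Under an i.i.d.
law with distribution function `F` the expected integrand is
`(1 - x ^ n) (1 - t φ t) - Φ t (1 - n x ^ (n - 1) + (n - 1) x ^ n)` at `x = F t`. The density `φ`
is chosen so that this polynomial is maximal over `x ≥ 0` at `x = 1 - r / t`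
(`level_le_levelRegret`, which reduces to Bernoulli's inequality), and the maxima integrate to `V`.

*Lower bound.* Shifting payments so that a buyer of value `0` gets utility `0` only raises revenue
and makes everything bounded. For a single buyer with utility `u` and allocation `x` the payment
`t x t - u t` weighted by the isorevenue density `r / t ^ 2` is the derivative of `r u t / t`, so,
with the atom at `1`, the expected payment is `r x 1 - u r ≤ r x 1`. Summing over buyers, the revenue is at most the probability
`1 - (1 - r) ^ n` that some value equals `1`, and the expected maximum exceeds this by `V`.
-/

/-! ### Remainders of the logarithmic series -/

/-- The remainder `∑_{k > m} q ^ k / k` of the power series of `-log (1 - q)`, in closed form. -/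
noncomputable def logTail (m : ℕ) (q : ℝ) : ℝ :=
  -Real.log (1 - q) - ∑ k ∈ Finset.Icc 1 m, q ^ k / (k : ℝ)

theorem logTail_succ (m : ℕ) (q : ℝ) :
    logTail (m + 1) q = logTail m q - q ^ (m + 1) / ((m : ℝ) + 1) := by
  unfold logTail
  rw [Finset.sum_Icc_succ_top (by omega)]
  push_cast
  ring

theorem hasDerivAt_logTail (m : ℕ) {q : ℝ} (hq : q < 1) :
    HasDerivAt (logTail m) (q ^ m / (1 - q)) q := by
  have h1 : 1 - q ≠ 0 := by linarith
  induction m with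
  | zero =>
    have h := (((hasDerivAt_id q).const_sub 1).log h1).neg
    have e : logTail 0 = -fun y => Real.log (1 - y) := by
      funext y; simp [logTail]
    rw [e]
    exact h.congr_deriv (by simp [neg_div])
  | succ m ih =>
    have h := ih.sub ((hasDerivAt_pow (m + 1) q).div_const ((m : ℝ) + 1))
    have e : logTail (m + 1) = logTail m - fun y => y ^ (m + 1) / ((m : ℝ) + 1) := by
      funext y; exact logTail_succ m y
    rw [e]
    have : (m : ℝ) + 1 ≠ 0 := by positivity
    refine h.congr_deriv ?_
    push_cast
    field_simp
    ring

theorem logTail_zero_right (m : ℕ) : logTail m 0 = 0 := by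
  unfold logTail
  rw [Finset.sum_eq_zero]
  · simp
  · intro k hk
    rw [Finset.mem_Icc] at hk
    rw [zero_pow (by omega), zero_div]

theorem continuousOn_logTail (m : ℕ) : ContinuousOn (logTail m) (Iio 1) := fun _ hq =>
  (hasDerivAt_logTail m hq).continuousAt.continuousWithinAt

theorem logTail_nonneg (m : ℕ) {q : ℝ} (h0 : 0 ≤ q) (h1 : q < 1) : 0 ≤ logTail m q := by
  have hmono : MonotoneOn (logTail m) (Ico 0 1) := by
    refine monotoneOn_of_hasDerivWithinAt_nonneg (f' := fun q => q ^ m / (1 - q)) (convex_Ico 0 1)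
      ((continuousOn_logTail m).mono fun x hx => hx.2) (fun x hx => ?_) (fun x hx => ?_)
    · rw [interior_Ico] at hx
      exact (hasDerivAt_logTail m hx.2).hasDerivWithinAt
    · rw [interior_Ico] at hx
      have := sub_pos.2 hx.2
      have := hx.1
      positivity
  simpa [logTail_zero_right] using hmono ⟨le_rfl, one_pos⟩ ⟨h0, h1⟩ h0

/-- Comparison of the tail `∑_{k > m} q ^ k / k` with the geometric series
`∑_{k > m} q ^ k / (m + 1)`. -/
theorem logTail_le (m : ℕ) {q : ℝ} (h0 : 0 ≤ q) (h1 : q < 1) :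
    logTail m q ≤ q ^ (m + 1) / (((m : ℝ) + 1) * (1 - q)) := by
  have hm : (m : ℝ) + 1 ≠ 0 := by positivity
  have hd : ∀ x : ℝ, x < 1 → HasDerivAt
      (fun q => q ^ (m + 1) / (((m : ℝ) + 1) * (1 - q)) - logTail m q)
      (x ^ (m + 1) / (((m : ℝ) + 1) * (1 - x) ^ 2)) x := by
    intro x hx
    have hx' : 1 - x ≠ 0 := by linarith
    have h := ((hasDerivAt_pow (m + 1) x).div
      (((hasDerivAt_id x).const_sub 1).const_mul ((m : ℝ) + 1)) (mul_ne_zero hm hx')).sub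
      (hasDerivAt_logTail m hx)
    refine h.congr_deriv ?_
    push_cast
    simp only [id]
    field_simp
    ring
  have hmono : MonotoneOn (fun q => q ^ (m + 1) / (((m : ℝ) + 1) * (1 - q)) - logTail m q)
      (Ico 0 1) := by
    refine monotoneOn_of_hasDerivWithinAt_nonneg
      (f' := fun x => x ^ (m + 1) / (((m : ℝ) + 1) * (1 - x) ^ 2)) (convex_Ico 0 1)
      (fun x hx => (hd x hx.2).continuousAt.continuousWithinAt) (fun x hx => ?_) (fun x hx => ?_)
    · rw [interior_Ico] at hx
      exact (hd x hx.2).hasDerivWithinAt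
    · rw [interior_Ico] at hx
      have := hx.1
      positivity
  have := hmono ⟨le_rfl, one_pos⟩ ⟨h0, h1⟩ h0
  simp [logTail_zero_right] at this
  linarith

/-! ### The reserve equation -/

theorem reserveEquation_iff (m : ℕ) (r : ℝ) :
    ReserveEquation (m + 1) r ↔ logTail m (1 - r) = (1 - r) ^ m := by
  unfold ReserveEquation logTail
  simp only [Nat.add_sub_cancel, sub_sub_cancel]
  constructor <;> intro h <;> linarith

theorem hasDerivAt_reserveEquation (m : ℕ) {r : ℝ} (hr : 0 < r) :
    HasDerivAt (fun r => (1 - r) ^ m - logTail m (1 - r))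
      ((1 - r) ^ m / r - m * (1 - r) ^ (m - 1)) r := by
  have h1 : HasDerivAt (fun r : ℝ => 1 - r) (-1) r := by
    simpa using (hasDerivAt_id r).const_sub 1
  have h2 := (h1.pow m).sub
    (HasDerivAt.comp (h₂ := logTail m) r (hasDerivAt_logTail m (by linarith : 1 - r < 1)) h1)
  refine h2.congr_deriv ?_
  rw [sub_sub_cancel]
  ring

/-- Below `1 / (m + 1)` the defining function of the reserve equation is strictly increasing: its
derivative is `(1 - r) ^ (m - 1) * (1 - (m + 1) * r) / r`. -/
theorem strictMonoOn_reserveEquation (m : ℕ) :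
    StrictMonoOn (fun r => (1 - r) ^ m - logTail m (1 - r)) (Ioc 0 (1 / ((m + 1 : ℕ) : ℝ))) := by
  refine strictMonoOn_of_hasDerivWithinAt_pos
    (f' := fun r => (1 - r) ^ m / r - m * (1 - r) ^ (m - 1)) (convex_Ioc _ _)
    (fun x hx => (hasDerivAt_reserveEquation m hx.1).continuousAt.continuousWithinAt)
    (fun x hx => ?_) (fun x hx => ?_)
  · rw [interior_Ioc] at hx
    exact (hasDerivAt_reserveEquation m hx.1).hasDerivWithinAt
  · rw [interior_Ioc] at hx
    obtain ⟨h0, h1⟩ := hx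
    have hm : (0 : ℝ) ≤ m := m.cast_nonneg
    rw [lt_div_iff₀ (by positivity)] at h1
    push_cast at h1
    rcases m with _ | m
    · simpa using h0
    · have h2 : 0 < 1 - x := by
        push_cast at h1
        nlinarith [m.cast_nonneg (α := ℝ)]
      have h3 : 0 < (1 - x) ^ m := by positivity
      have e : (1 - x) ^ (m + 1) / x - ((m + 1 : ℕ) : ℝ) * (1 - x) ^ (m + 1 - 1)
          = (1 - x) ^ m * (1 - x * (((m + 1 : ℕ) : ℝ) + 1)) / x := by
        simp only [Nat.add_sub_cancel]
        field_simp
        ring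
      rw [e]
      exact div_pos (mul_pos h3 (by linarith)) h0

theorem exists_reserveEquation (m : ℕ) :
    ∃ r ∈ Ioo (0 : ℝ) (1 / ((m + 1 : ℕ) : ℝ)), ReserveEquation (m + 1) r := by
  set b : ℝ := 1 / ((m + 1 : ℕ) : ℝ) with hb
  set a : ℝ := Real.exp (-((m : ℝ) + 2)) with ha
  have hm : (0 : ℝ) ≤ m := m.cast_nonneg
  have ha0 : 0 < a := Real.exp_pos _
  have hab : a < b := by
    rw [ha, hb, Real.exp_neg, ← one_div]
    refine one_div_lt_one_div_of_lt (by positivity) ?_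
    push_cast
    linarith [Real.add_one_le_exp ((m : ℝ) + 2)]
  have ha1 : a < 1 := by
    rw [ha, Real.exp_lt_one_iff]
    linarith
  have hb0 : 0 < b := ha0.trans hab
  have hb1 : b ≤ 1 := by
    rw [hb, div_le_one (by positivity)]
    push_cast
    linarith
  have hneg : (1 - a) ^ m - logTail m (1 - a) < 0 := by
    -- every power of `1 - a` is at most `1`, while `log a = -(m + 2)`
    have h1 : (1 - a) ^ m ≤ 1 := pow_le_one₀ (by linarith) (by linarith)
    have h2 : ∑ k ∈ Finset.Icc 1 m, (1 - a) ^ k / (k : ℝ) ≤ m := by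
      calc ∑ k ∈ Finset.Icc 1 m, (1 - a) ^ k / (k : ℝ) ≤ ∑ k ∈ Finset.Icc 1 m, (1 : ℝ) := by
            refine Finset.sum_le_sum fun k hk => ?_
            rw [Finset.mem_Icc] at hk
            have hk1 : (1 : ℝ) ≤ k := by exact_mod_cast hk.1
            rw [div_le_one (by linarith)]
            exact (pow_le_one₀ (by linarith) (by linarith)).trans hk1
        _ = m := by simp
    unfold logTail
    rw [sub_sub_cancel, ha, Real.log_exp, ← ha]
    linarith
  have hpos : 0 < (1 - b) ^ m - logTail m (1 - b) := by
    have h1 := logTail_le m (q := 1 - b) (by linarith) (by linarith)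
    have h2 : (1 - b) ^ (m + 1) / (((m : ℝ) + 1) * (1 - (1 - b))) = (1 - b) ^ m * (1 - b) := by
      have : (m : ℝ) + 1 ≠ 0 := by positivity
      rw [sub_sub_cancel, hb]
      push_cast
      rw [mul_one_div_cancel this, div_one, pow_succ]
    rw [h2] at h1
    have h3 : 0 < (1 - b) ^ m := by
      rcases m with _ | m
      · simp
      · have : b < 1 := by
          rw [hb, div_lt_one (by positivity)]
          push_cast
          linarith [m.cast_nonneg (α := ℝ)]
        exact pow_pos (by linarith) _
    nlinarith
  have hc : ContinuousOn (fun r => (1 - r) ^ m - logTail m (1 - r)) (Icc a b) := fun x hx =>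
    (hasDerivAt_reserveEquation m (ha0.trans_le hx.1)).continuousAt.continuousWithinAt
  obtain ⟨r, hr, he⟩ := intermediate_value_Ioo hab.le hc (show (0 : ℝ) ∈ Ioo _ _ from ⟨hneg, hpos⟩)
  refine ⟨r, ⟨ha0.trans hr.1, hr.2⟩, (reserveEquation_iff m r).2 ?_⟩
  simp only at he
  linarith

theorem reserveEquation_unique (m : ℕ) {r s : ℝ} (hr : r ∈ Ioo (0 : ℝ) (1 / ((m + 1 : ℕ) : ℝ)))
    (hs : s ∈ Ioo (0 : ℝ) (1 / ((m + 1 : ℕ) : ℝ))) (her : ReserveEquation (m + 1) r)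
    (hes : ReserveEquation (m + 1) s) : s = r := by
  rw [reserveEquation_iff] at her hes
  refine (strictMonoOn_reserveEquation m).injOn (Ioo_subset_Ioc_self hs)
    (Ioo_subset_Ioc_self hr) ?_
  simp only [her, hes, sub_self]

/-! ### The law of the reserve price -/

theorem hasDerivAt_logTail_isorevenue (m : ℕ) {r t : ℝ} (hr : 0 < r) (ht : r < t) :
    HasDerivAt (fun t => logTail m (1 - r / t)) ((1 - r / t) ^ m / t) t := by
  have ht0 : t ≠ 0 := (hr.trans ht).ne'
  have h1 : HasDerivAt (fun t : ℝ => 1 - r / t) (r / t ^ 2) t :=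
    (((hasDerivAt_const t r).div (hasDerivAt_id t) ht0).const_sub 1).congr_deriv (by simp [neg_div])
  have hq : 1 - r / t < 1 := by
    have := div_pos hr (hr.trans ht)
    linarith
  refine (HasDerivAt.comp (h₂ := logTail m) t (hasDerivAt_logTail m hq) h1).congr_deriv ?_
  have := hr.ne'
  rw [sub_sub_cancel]
  field_simp

theorem isorevenue_mem {r t : ℝ} (hr : 0 < r) (ht : r < t) : 1 - r / t ∈ Ioo (0 : ℝ) 1 := by
  have h1 : r / t < 1 := (div_lt_one (hr.trans ht)).2 ht
  have h2 := div_pos hr (hr.trans ht)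
  exact ⟨by linarith, by linarith⟩

/-- In terms of `q = 1 - r / t` the reserve price distribution function is
`∑_{k > m} q ^ (k - m) / k`. -/
theorem reserveCDF_eq (m : ℕ) {r t : ℝ} (hr : 0 < r) (ht : r < t) (ht1 : t ≤ 1) :
    reserveCDF (m + 1) r t = logTail m (1 - r / t) / (1 - r / t) ^ m := by
  have hq := (isorevenue_mem hr ht).1
  have ht0 : 0 < t := hr.trans ht
  have e : t / (t - r) = (1 - r / t)⁻¹ := by
    have : t - r ≠ 0 := by linarith
    rw [one_sub_div ht0.ne', inv_div]
  have e2 : Real.log (t / r) = -Real.log (r / t) := by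
    rw [← Real.log_inv, inv_div]
  unfold reserveCDF logTail
  rw [if_neg (by linarith), if_pos ht1, e, e2, sub_sub_cancel, sub_div, Finset.sum_div]
  congr 1
  · rw [Nat.add_sub_cancel, inv_pow]
    ring
  · refine Finset.sum_congr rfl fun k hk => ?_
    rw [Finset.mem_Icc] at hk
    simp only [Nat.add_sub_cancel]
    rw [inv_pow, pow_sub₀ _ hq.ne' hk.2]
    field_simp

theorem reserveCDF_of_le (n : ℕ) {r t : ℝ} (ht : t ≤ r) : reserveCDF n r t = 0 := if_pos ht

theorem reserveCDF_one {m : ℕ} {r : ℝ} (hr : 0 < r) (hr1 : r < 1)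
    (he : ReserveEquation (m + 1) r) : reserveCDF (m + 1) r 1 = 1 := by
  rw [reserveEquation_iff] at he
  rw [reserveCDF_eq m hr hr1 le_rfl, div_one, he, div_self]
  exact pow_ne_zero _ (by linarith)

theorem measurable_reserveCDF (n : ℕ) (r : ℝ) : Measurable (reserveCDF n r) := by
  unfold reserveCDF
  refine Measurable.ite measurableSet_Iic measurable_const
    (Measurable.ite measurableSet_Iic ?_ measurable_const)
  fun_prop

theorem reserveCDF_nonneg (m : ℕ) {r t : ℝ} (hr : 0 < r) : 0 ≤ reserveCDF (m + 1) r t := by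
  rcases le_or_gt t r with h | h
  · rw [reserveCDF_of_le _ h]
  rcases le_or_gt t 1 with h1 | h1
  · have hq := isorevenue_mem hr h
    rw [reserveCDF_eq m hr h h1]
    exact div_nonneg (logTail_nonneg m hq.1.le hq.2) (pow_nonneg hq.1.le _)
  · unfold reserveCDF
    rw [if_neg (by linarith), if_neg (by linarith)]
    exact zero_le_one

/-- The bound behind both the continuity of the distribution function at `r` and the
nonnegativity of its density. -/
theorem reserveCDF_le (m : ℕ) {r t : ℝ} (hr : 0 < r) (ht : r < t) (ht1 : t ≤ 1) :
    reserveCDF (m + 1) r t ≤ (t - r) / (r * ((m : ℝ) + 1)) := by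
  have hq := isorevenue_mem hr ht
  have ht0 : 0 < t := hr.trans ht
  have hqm : 0 < (1 - r / t) ^ m := pow_pos hq.1 m
  rw [reserveCDF_eq m hr ht ht1, div_le_iff₀ hqm]
  refine (logTail_le m hq.1.le hq.2).trans_eq ?_
  rw [pow_succ, sub_sub_cancel]
  have : (m : ℝ) + 1 ≠ 0 := by positivity
  field_simp

/-- The density of the reserve price. On `(r, 1]` it solves the linear differential equation
`t * (t - r) * φ + m * r * Φ = t - r`, which makes `1 - r / t` the worst-case value of the
distribution function of valuations at `t`. -/
noncomputable def reserveDensity (m : ℕ) (r t : ℝ) : ℝ :=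
  if t ∈ Ioc r 1 then (1 - m * (r / (t - r)) * reserveCDF (m + 1) r t) / t else 0

theorem measurable_reserveDensity (m : ℕ) (r : ℝ) : Measurable (reserveDensity m r) := by
  unfold reserveDensity
  have := measurable_reserveCDF (m + 1) r
  refine Measurable.ite measurableSet_Ioc ?_ measurable_const
  fun_prop

theorem mul_reserveDensity_mem (m : ℕ) {r : ℝ} (hr : 0 < r) (t : ℝ) :
    t * reserveDensity m r t ∈ Icc (0 : ℝ) 1 := by
  unfold reserveDensity
  split_ifs with h
  · obtain ⟨h0, h1⟩ := h
    have ht0 : 0 < t := hr.trans h0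
    have hs : 0 < t - r := sub_pos.2 h0
    rw [mul_div_cancel₀ _ ht0.ne']
    have hm : (0 : ℝ) ≤ m := m.cast_nonneg
    have hc : 0 ≤ (m : ℝ) * (r / (t - r)) := by positivity
    have h2 := mul_nonneg hc (reserveCDF_nonneg m hr (t := t))
    have h3 := mul_le_mul_of_nonneg_left (reserveCDF_le m hr h0 h1) hc
    have h4 : (m : ℝ) * (r / (t - r)) * ((t - r) / (r * ((m : ℝ) + 1))) = m / (m + 1) := by
      field_simp
    have h5 : (m : ℝ) / (m + 1) ≤ 1 := by
      rw [div_le_one (by positivity)]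
      linarith
    constructor <;> linarith
  · simp

theorem reserveDensity_nonneg (m : ℕ) {r : ℝ} (hr : 0 < r) (t : ℝ) : 0 ≤ reserveDensity m r t := by
  by_cases h : t ∈ Ioc r 1
  · exact nonneg_of_mul_nonneg_right (mul_reserveDensity_mem m hr t).1 (hr.trans h.1)
  · rw [reserveDensity, if_neg h]

theorem integrable_reserveDensity (m : ℕ) {r : ℝ} (hr : 0 < r) :
    Integrable (reserveDensity m r) := by
  have e : reserveDensity m r = (Ioc r 1).indicator (reserveDensity m r) := by
    funext t
    by_cases h : t ∈ Ioc r 1 <;> simp [reserveDensity, h]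
  rw [e, integrable_indicator_iff measurableSet_Ioc]
  refine IntegrableOn.of_bound measure_Ioc_lt_top
    (measurable_reserveDensity m r).aestronglyMeasurable (1 / r)
    ((ae_restrict_iff' measurableSet_Ioc).2 (ae_of_all _ fun t ht => ?_))
  rw [Real.norm_of_nonneg (reserveDensity_nonneg m hr t), le_div_iff₀ hr]
  calc reserveDensity m r t * r ≤ reserveDensity m r t * t :=
        mul_le_mul_of_nonneg_left ht.1.le (reserveDensity_nonneg m hr t)
    _ ≤ 1 := by rw [mul_comm]; exact (mul_reserveDensity_mem m hr t).2

theorem hasDerivAt_reserveCDF (m : ℕ) {r t : ℝ} (hr : 0 < r) (ht : t ∈ Ioo r 1) :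
    HasDerivAt (reserveCDF (m + 1) r) (reserveDensity m r t) t := by
  have ht0 : 0 < t := hr.trans ht.1
  have hs : t - r ≠ 0 := (sub_pos.2 ht.1).ne'
  have hq := isorevenue_mem hr ht.1
  have h1 : HasDerivAt (fun t : ℝ => 1 - r / t) (r / t ^ 2) t :=
    (((hasDerivAt_const t r).div (hasDerivAt_id t) ht0.ne').const_sub 1).congr_deriv
      (by simp [neg_div])
  have h2 := (hasDerivAt_logTail_isorevenue m hr ht.1).div (h1.pow m) (pow_ne_zero m hq.1.ne')
  have e : reserveCDF (m + 1) r =ᶠ[nhds t]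
      (fun t => logTail m (1 - r / t)) / (fun t : ℝ => 1 - r / t) ^ m := by
    filter_upwards [Ioo_mem_nhds ht.1 ht.2] with s hs
    simpa using reserveCDF_eq m hr hs.1 hs.2.le
  refine (h2.congr_of_eventuallyEq e).congr_deriv ?_
  rw [reserveDensity, if_pos ⟨ht.1, ht.2.le⟩, reserveCDF_eq m hr ht.1 ht.2.le]
  have hq0 := hq.1.ne'
  have e3 : r / (t - r) = r / t / (1 - r / t) := by
    rw [one_sub_div ht0.ne']
    field_simp
  rw [e3]
  simp only [Pi.pow_apply]
  generalize 1 - r / t = q at hq0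
  generalize logTail m q = l
  rcases m with _ | m
  · simp
  · rw [Nat.add_sub_cancel]
    field_simp
    ring

theorem continuousOn_reserveCDF {m : ℕ} {r : ℝ} (hr : 0 < r) :
    ContinuousOn (reserveCDF (m + 1) r) (Icc r 1) := by
  intro t ht
  rcases ht.1.eq_or_lt with h | h
  · -- squeeze at the left end point
    subst h
    have h0 : reserveCDF (m + 1) r r = 0 := reserveCDF_of_le _ le_rfl
    unfold ContinuousWithinAt
    rw [h0]
    have hlim : Filter.Tendsto (fun t => (t - r) / (r * ((m : ℝ) + 1))) (nhdsWithin r (Icc r 1))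
        (nhds 0) := by
      have : Continuous fun t => (t - r) / (r * ((m : ℝ) + 1)) := by fun_prop
      simpa using (this.tendsto r).mono_left nhdsWithin_le_nhds
    refine tendsto_of_tendsto_of_tendsto_of_le_of_le' tendsto_const_nhds hlim
      (Filter.Eventually.of_forall fun t => reserveCDF_nonneg m hr) ?_
    filter_upwards [self_mem_nhdsWithin] with s hs
    rcases hs.1.eq_or_lt with h | h
    · rw [← h, h0, sub_self, zero_div]
    · exact reserveCDF_le m hr h hs.2
  · have hq := isorevenue_mem hr h
    have h1 : ContinuousWithinAt (fun t => logTail m (1 - r / t) / (1 - r / t) ^ m) (Icc r 1) t := by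
      have hd : ContinuousAt (fun t : ℝ => 1 - r / t) t :=
        continuousAt_const.sub (continuousAt_const.div continuousAt_id (hr.trans h).ne')
      exact ((hasDerivAt_logTail_isorevenue m hr h).continuousAt.div (hd.pow m)
        (pow_ne_zero m hq.1.ne')).continuousWithinAt
    refine h1.congr_of_eventuallyEq ?_ (reserveCDF_eq m hr h ht.2)
    filter_upwards [mem_nhdsWithin_of_mem_nhds (Ioi_mem_nhds h), self_mem_nhdsWithin] with s hs hs1
    exact reserveCDF_eq m hr hs hs1.2

theorem integral_reserveDensity (m : ℕ) {r v : ℝ} (hr : 0 < r) (hv : v ∈ Icc r 1) :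
    ∫ t in r..v, reserveDensity m r t = reserveCDF (m + 1) r v := by
  rw [intervalIntegral.integral_eq_sub_of_hasDerivAt_of_le hv.1
    ((continuousOn_reserveCDF hr).mono (Icc_subset_Icc_right hv.2))
    (fun t ht => hasDerivAt_reserveCDF m hr ⟨ht.1, ht.2.trans_le hv.2⟩)
    (integrable_reserveDensity m hr).intervalIntegrable, reserveCDF_of_le _ le_rfl, sub_zero]

/-- The law of the reserve price. -/
noncomputable def reserveLaw (m : ℕ) (r : ℝ) : Measure ℝ :=
  volume.withDensity fun t => ENNReal.ofReal (reserveDensity m r t)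

theorem reserveLaw_apply (m : ℕ) {r : ℝ} (hr : 0 < r) {s : Set ℝ} (hs : MeasurableSet s) :
    reserveLaw m r s = ENNReal.ofReal (∫ t in s, reserveDensity m r t) := by
  rw [reserveLaw, withDensity_apply _ hs, ofReal_integral_eq_lintegral_ofReal
    (integrable_reserveDensity m hr).integrableOn (ae_of_all _ (reserveDensity_nonneg m hr))]

theorem setIntegral_reserveDensity (m : ℕ) (r : ℝ) {s : Set ℝ} (hs : MeasurableSet s) :
    ∫ t in s, reserveDensity m r t = ∫ t in s ∩ Ioc r 1, reserveDensity m r t := by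
  apply setIntegral_eq_of_subset_of_forall_sdiff_eq_zero hs inter_subset_left
  intro t ht
  rw [reserveDensity, if_neg fun h => ht.2 ⟨ht.1, h⟩]

theorem reserveLaw_Iic {m : ℕ} {r : ℝ} (hr : 0 < r) (hr1 : r < 1)
    (he : ReserveEquation (m + 1) r) (v : ℝ) :
    reserveLaw m r (Iic v) = ENNReal.ofReal (reserveCDF (m + 1) r v) := by
  rw [reserveLaw_apply m hr measurableSet_Iic, setIntegral_reserveDensity m r measurableSet_Iic,
    inter_comm, Ioc_inter_Iic]
  congr 1
  rcases le_or_gt v r with h | h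
  · rw [Ioc_eq_empty (by simp [h]), reserveCDF_of_le _ h, Measure.restrict_empty,
      integral_zero_measure]
  rcases le_or_gt v 1 with h1 | h1
  · rw [min_eq_right h1, ← intervalIntegral.integral_of_le h.le,
      integral_reserveDensity m hr ⟨h.le, h1⟩]
  · rw [min_eq_left h1.le, ← intervalIntegral.integral_of_le hr1.le,
      integral_reserveDensity m hr ⟨hr1.le, le_rfl⟩, reserveCDF_one hr hr1 he, reserveCDF,
      if_neg (by linarith), if_neg (by linarith)]

theorem isProbabilityMeasure_reserveLaw {m : ℕ} {r : ℝ} (hr : 0 < r) (hr1 : r < 1)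
    (he : ReserveEquation (m + 1) r) : IsProbabilityMeasure (reserveLaw m r) := by
  refine ⟨?_⟩
  rw [reserveLaw_apply m hr MeasurableSet.univ, setIntegral_reserveDensity m r MeasurableSet.univ,
    univ_inter, ← intervalIntegral.integral_of_le hr1.le,
    integral_reserveDensity m hr ⟨hr1.le, le_rfl⟩, reserveCDF_one hr hr1 he, ENNReal.ofReal_one]

theorem ae_mem_reserveLaw (m : ℕ) {r : ℝ} (hr : 0 < r) : ∀ᵐ p ∂reserveLaw m r, p ∈ Ioc r 1 := by
  rw [ae_iff, show {p | p ∉ Ioc r 1} = (Ioc r 1)ᶜ from rfl,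
    reserveLaw_apply m hr measurableSet_Ioc.compl,
    setIntegral_reserveDensity m r measurableSet_Ioc.compl]
  simp

theorem cdf_reserveLaw {m : ℕ} {r : ℝ} (hr : 0 < r) (hr1 : r < 1)
    (he : ReserveEquation (m + 1) r) (v : ℝ) :
    ProbabilityTheory.cdf (reserveLaw m r) v = reserveCDF (m + 1) r v := by
  have := isProbabilityMeasure_reserveLaw hr hr1 he
  rw [ProbabilityTheory.cdf_eq_real, Measure.real, reserveLaw_Iic hr hr1 he,
    ENNReal.toReal_ofReal (reserveCDF_nonneg m hr)]

theorem reserveCDF_le_one {m : ℕ} {r : ℝ} (hr : 0 < r) (hr1 : r < 1)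
    (he : ReserveEquation (m + 1) r) (v : ℝ) : reserveCDF (m + 1) r v ≤ 1 := by
  rw [← cdf_reserveLaw hr hr1 he]
  exact ProbabilityTheory.cdf_le_one _ _

/-! ### The isorevenue distribution -/

/-- The isorevenue distribution: density `r / t ^ 2` on `(r, 1)` and an atom of mass `r` at `1`. -/
noncomputable def isorevenueLaw (r : ℝ) : Measure ℝ :=
  (volume.restrict (Ioc r 1)).withDensity (fun t => ENNReal.ofReal (r / t ^ 2))
    + ENNReal.ofReal r • Measure.dirac 1

theorem integrableOn_div_sq {r : ℝ} (hr : 0 < r) :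
    IntegrableOn (fun t : ℝ => r / t ^ 2) (Ioc r 1) := by
  have : ContinuousOn (fun t : ℝ => r / t ^ 2) (Icc r 1) :=
    continuousOn_const.div (continuousOn_id.pow 2) fun t ht =>
      pow_ne_zero 2 (hr.trans_le ht.1).ne'
  exact this.integrableOn_Icc.mono_set Ioc_subset_Icc_self

theorem integral_div_sq {r v : ℝ} (hr : 0 < r) (hv : r ≤ v) :
    ∫ t in r..v, r / t ^ 2 = 1 - r / v := by
  have h : ∀ t ∈ uIcc r v, HasDerivAt (fun t : ℝ => 1 - r / t) (r / t ^ 2) t := by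
    intro t ht
    rw [uIcc_of_le hv] at ht
    exact (((hasDerivAt_const t r).div (hasDerivAt_id t)
      (hr.trans_le ht.1).ne').const_sub 1).congr_deriv (by simp [neg_div])
  rw [intervalIntegral.integral_eq_sub_of_hasDerivAt h]
  · simp [hr.ne']
  · refine ContinuousOn.intervalIntegrable ?_
    rw [uIcc_of_le hv]
    exact continuousOn_const.div (continuousOn_id.pow 2) fun t ht =>
      pow_ne_zero 2 (hr.trans_le ht.1).ne'

theorem isorevenueLaw_apply {r : ℝ} (hr : 0 < r) {s : Set ℝ} (hs : MeasurableSet s) :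
    isorevenueLaw r s = ENNReal.ofReal (∫ t in s ∩ Ioc r 1, r / t ^ 2)
      + ENNReal.ofReal r * s.indicator 1 1 := by
  rw [isorevenueLaw, Measure.add_apply, Measure.smul_apply, Measure.dirac_apply' _ hs,
    withDensity_apply _ hs, Measure.restrict_restrict hs, smul_eq_mul,
    ofReal_integral_eq_lintegral_ofReal ((integrableOn_div_sq hr).mono_set inter_subset_right)]
  exact ae_of_all _ fun t => by positivity

theorem isorevenueLaw_Iic {r : ℝ} (hr : 0 < r) (hr1 : r < 1) (v : ℝ) :
    isorevenueLaw r (Iic v) = ENNReal.ofReal (isorevenueCDF r v) := by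
  rw [isorevenueLaw_apply hr measurableSet_Iic, inter_comm, Ioc_inter_Iic, isorevenueCDF]
  split_ifs with h h1
  · rw [Ioc_eq_empty (by simp [h.le])]
    simp [show ¬ (1 : ℝ) ≤ v by linarith]
  · rw [min_eq_right h1.le, ← intervalIntegral.integral_of_le (not_lt.1 h),
      integral_div_sq hr (not_lt.1 h)]
    simp [show ¬ (1 : ℝ) ≤ v by linarith]
  · rw [min_eq_left (not_lt.1 h1), ← intervalIntegral.integral_of_le hr1.le,
      integral_div_sq hr hr1.le, indicator_of_mem (by simpa using h1), Pi.one_apply, mul_one,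
      ← ENNReal.ofReal_add (by rw [div_one]; linarith) hr.le]
    simp

theorem isProbabilityMeasure_isorevenueLaw {r : ℝ} (hr : 0 < r) (hr1 : r < 1) :
    IsProbabilityMeasure (isorevenueLaw r) := by
  refine ⟨?_⟩
  rw [isorevenueLaw_apply hr MeasurableSet.univ, univ_inter,
    ← intervalIntegral.integral_of_le hr1.le, integral_div_sq hr hr1.le,
    indicator_of_mem (mem_univ _), Pi.one_apply, mul_one,
      ← ENNReal.ofReal_add (by rw [div_one]; linarith) hr.le]
  simp

theorem cdf_isorevenueLaw {r : ℝ} (hr : 0 < r) (hr1 : r < 1) (v : ℝ) :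
    ProbabilityTheory.cdf (isorevenueLaw r) v = isorevenueCDF r v := by
  have := isProbabilityMeasure_isorevenueLaw hr hr1
  rw [ProbabilityTheory.cdf_eq_real, Measure.real, isorevenueLaw_Iic hr hr1,
    ENNReal.toReal_ofReal]
  unfold isorevenueCDF
  split_ifs with h h1
  · exact le_rfl
  · have := (div_le_one (hr.trans_le (not_lt.1 h))).2 (not_lt.1 h)
    linarith
  · exact zero_le_one

theorem isorevenueLaw_compl_Icc {r : ℝ} (hr : 0 < r) : isorevenueLaw r (Icc 0 1)ᶜ = 0 := by
  have h : (Icc (0 : ℝ) 1)ᶜ ∩ Ioc r 1 = ∅ := by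
    ext t
    simp only [mem_inter_iff, mem_compl_iff, mem_Icc, mem_Ioc, mem_empty_iff_false, iff_false]
    rintro ⟨h1, h2⟩
    exact h1 ⟨hr.le.trans h2.1.le, h2.2⟩
  rw [isorevenueLaw_apply hr measurableSet_Icc.compl, h]
  simp

theorem integral_isorevenueLaw {r : ℝ} (hr : 0 < r) (hr1 : r ≤ 1) {g : ℝ → ℝ}
    (hg : Integrable g (isorevenueLaw r)) :
    ∫ t, g t ∂isorevenueLaw r = (∫ t in r..1, r / t ^ 2 * g t) + r * g 1 := by
  have hg' := hg
  rw [isorevenueLaw, integrable_add_measure] at hg'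
  rw [isorevenueLaw, integral_add_measure hg'.1 hg'.2, integral_smul_measure, integral_dirac,
    ENNReal.toReal_ofReal hr.le, smul_eq_mul,
    integral_withDensity_eq_integral_toReal_smul (by fun_prop) (by simp),
    intervalIntegral.integral_of_le hr1]
  congr 1
  refine integral_congr_ae (ae_of_all _ fun t => ?_)
  simp only [smul_eq_mul]
  rw [ENNReal.toReal_ofReal (by positivity)]

/-! ### Second-price auctions with a random reserve -/

theorem competingBid_le {n : ℕ} {v : Fin n → ℝ} {i : Fin n} {a : ℝ} (ha : 0 ≤ a)
    (h : ∀ j, j ≠ i → v j ≤ a) : competingBid v i ≤ a :=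
  Real.iSup_le (fun j => h j j.2) ha

theorem le_competingBid {n : ℕ} (v : Fin n → ℝ) {i j : Fin n} (h : j ≠ i) :
    v j ≤ competingBid v i :=
  le_ciSup (f := fun j : {j : Fin n // j ≠ i} => v j) (finite_range _).bddAbove ⟨j, h⟩

theorem competingBid_update {n : ℕ} (v : Fin n → ℝ) (i : Fin n) (b : ℝ) :
    competingBid (Function.update v i b) i = competingBid v i := by
  unfold competingBid
  exact iSup_congr fun j => Function.update_of_ne j.2 _ _

theorem measurable_competingBid {n : ℕ} (i : Fin n) :
    Measurable fun v : Fin n → ℝ => competingBid v i :=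
  Measurable.iSup fun _ => measurable_pi_apply _

namespace IsTieBreaking

variable {n : ℕ} {τ : (Fin n → ℝ) → Fin n → ℝ}

theorem le_one (hτ : IsTieBreaking τ) (v : Fin n → ℝ) (i : Fin n) : τ v i ≤ 1 := by
  rw [← hτ.sum_eq_one v]
  exact Finset.single_le_sum (fun j _ => hτ.nonneg v j) (Finset.mem_univ i)

theorem eq_one (hτ : IsTieBreaking τ) {v : Fin n → ℝ} {i : Fin n} (h : competingBid v i < v i) :
    τ v i = 1 := by
  rw [← hτ.sum_eq_one v]
  refine (Finset.sum_eq_single i (fun j _ hj => ?_) (by simp)).symm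
  by_contra h0
  exact absurd (hτ.highest v j h0 i) (not_le.2 ((le_competingBid v hj).trans_lt h))

theorem exists_ne_zero (hτ : IsTieBreaking τ) (v : Fin n → ℝ) : ∃ i, τ v i ≠ 0 := by
  by_contra! h
  simpa [h] using hτ.sum_eq_one v

theorem secondPrice_ir (hτ : IsTieBreaking τ) {p : ℝ} (hp : 0 ≤ p) (v : Fin n → ℝ) (i : Fin n) :
    0 ≤ v i * (secondPrice τ p).alloc v i - (secondPrice τ p).pay v i := by
  simp only [secondPrice]
  split_ifs with h
  · rcases eq_or_ne (τ v i) 0 with h0 | h0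
    · simp [h0]
    · have h1 := competingBid_le (i := i) (hp.trans h) fun j _ => hτ.highest v i h0 j
      have h2 := mul_nonneg (hτ.nonneg v i) (sub_nonneg.2 (max_le h1 h))
      linarith
  · simp

theorem secondPrice_ic (hτ : IsTieBreaking τ) {p : ℝ} (hp : 0 ≤ p) (v : Fin n → ℝ) (i : Fin n)
    (b : ℝ) :
    v i * (secondPrice τ p).alloc (Function.update v i b) i
        - (secondPrice τ p).pay (Function.update v i b) i
      ≤ v i * (secondPrice τ p).alloc v i - (secondPrice τ p).pay v i := by
  have hir := hτ.secondPrice_ir hp v i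
  -- the price `max (competingBid v i) p` does not depend on the own bid
  have hl : v i * (secondPrice τ p).alloc (Function.update v i b) i
      - (secondPrice τ p).pay (Function.update v i b) i
      ≤ max (v i - max (competingBid v i) p) 0 := by
    simp only [secondPrice, competingBid_update]
    split_ifs with h
    · have h0 := hτ.nonneg (Function.update v i b) i
      have h1 := hτ.le_one (Function.update v i b) i
      calc v i * τ (Function.update v i b) i
            - τ (Function.update v i b) i * max (competingBid v i) p
          = τ (Function.update v i b) i * (v i - max (competingBid v i) p) := by ring
        _ ≤ τ (Function.update v i b) i * max (v i - max (competingBid v i) p) 0 :=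
            mul_le_mul_of_nonneg_left (le_max_left _ _) h0
        _ ≤ max (v i - max (competingBid v i) p) 0 :=
            mul_le_of_le_one_left (le_max_right _ _) h1
    · simp
  refine hl.trans (max_le ?_ hir)
  rcases lt_or_ge (max (competingBid v i) p) (v i) with h | h
  · have h1 := hτ.eq_one ((le_max_left _ _).trans_lt h)
    simp only [secondPrice]
    rw [if_pos ((le_max_right _ _).trans h.le), if_pos ((le_max_right _ _).trans h.le), h1]
    linarith
  · linarith

theorem integrable_alloc (hτ : IsTieBreaking τ) (ν : Measure ℝ) [IsFiniteMeasure ν]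
    (v : Fin n → ℝ) (i : Fin n) : Integrable (fun p => (secondPrice τ p).alloc v i) ν := by
  refine Integrable.of_bound (C := 1) ?_ (ae_of_all _ fun p => ?_)
  · exact (Measurable.ite measurableSet_Iic measurable_const
      measurable_const).aestronglyMeasurable
  · simp only [secondPrice]
    split_ifs
    · rw [Real.norm_of_nonneg (hτ.nonneg v i)]
      exact hτ.le_one v i
    · simp

theorem integrable_pay (hτ : IsTieBreaking τ) {ν : Measure ℝ} [IsFiniteMeasure ν]
    (hν : ∀ᵐ p ∂ν, p ∈ Ioc (0 : ℝ) 1) (v : Fin n → ℝ) (i : Fin n) :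
    Integrable (fun p => (secondPrice τ p).pay v i) ν := by
  refine Integrable.of_bound (C := max |competingBid v i| 1) ?_ ?_
  · refine (Measurable.ite measurableSet_Iic ?_ measurable_const).aestronglyMeasurable
    fun_prop
  · filter_upwards [hν] with p hp
    have h0 : (0 : ℝ) ≤ max |competingBid v i| 1 := zero_le_one.trans (le_max_right _ _)
    simp only [secondPrice]
    split_ifs
    · rw [norm_mul, Real.norm_of_nonneg (hτ.nonneg v i), Real.norm_eq_abs]
      have h1 : |max (competingBid v i) p| ≤ max |competingBid v i| 1 := by
        refine abs_max_le_max_abs_abs.trans (max_le_max le_rfl ?_)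
        rw [abs_of_pos hp.1]
        exact hp.2
      exact (mul_le_of_le_one_left (abs_nonneg _) (hτ.le_one v i)).trans h1
    · simp

theorem randomReserveSPA_utility (hτ : IsTieBreaking τ) {ν : Measure ℝ} [IsFiniteMeasure ν]
    (hν : ∀ᵐ p ∂ν, p ∈ Ioc (0 : ℝ) 1) (v : Fin n → ℝ) (i : Fin n) (w : ℝ) :
    w * (randomReserveSPA τ ν).alloc v i - (randomReserveSPA τ ν).pay v i
      = ∫ p, (w * (secondPrice τ p).alloc v i - (secondPrice τ p).pay v i) ∂ν := by
  rw [integral_sub ((hτ.integrable_alloc ν v i).const_mul w) (hτ.integrable_pay hν v i),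
    integral_const_mul]
  rfl

theorem isDSIC_randomReserveSPA (hτ : IsTieBreaking τ) (ν : Measure ℝ) [IsProbabilityMeasure ν]
    (hν : ∀ᵐ p ∂ν, p ∈ Ioc (0 : ℝ) 1) (D : Set ℝ) : IsDSIC D (randomReserveSPA τ ν) where
  measurable_alloc := by
    refine measurable_pi_iff.2 fun i => ?_
    have hτi : Measurable fun v => τ v i := (measurable_pi_apply i).comp hτ.measurable
    have hm : Measurable fun x : (Fin n → ℝ) × ℝ => if x.2 ≤ x.1 i then τ x.1 i else 0 :=
      Measurable.ite (measurableSet_le measurable_snd ((measurable_pi_apply i).comp measurable_fst))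
        (hτi.comp measurable_fst) measurable_const
    exact hm.stronglyMeasurable.integral_prod_right'.measurable
  measurable_pay := by
    refine measurable_pi_iff.2 fun i => ?_
    have hτi : Measurable fun v => τ v i := (measurable_pi_apply i).comp hτ.measurable
    have hm : Measurable fun x : (Fin n → ℝ) × ℝ =>
        if x.2 ≤ x.1 i then τ x.1 i * max (competingBid x.1 i) x.2 else 0 :=
      Measurable.ite (measurableSet_le measurable_snd ((measurable_pi_apply i).comp measurable_fst))
        ((hτi.comp measurable_fst).mul
          (((measurable_competingBid i).comp measurable_fst).max measurable_snd)) measurable_const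
    exact hm.stronglyMeasurable.integral_prod_right'.measurable
  alloc_mem v _ i := by
    constructor
    · refine integral_nonneg fun p => ?_
      simp only [secondPrice]
      split_ifs
      exacts [hτ.nonneg v i, le_rfl]
    · calc ∫ p, (secondPrice τ p).alloc v i ∂ν ≤ ∫ _, (1 : ℝ) ∂ν := by
            refine integral_mono (hτ.integrable_alloc ν v i) (integrable_const 1) fun p => ?_
            simp only [secondPrice]
            split_ifs
            exacts [hτ.le_one v i, zero_le_one]
        _ = 1 := by simp
  ir v _ i := by
    rw [hτ.randomReserveSPA_utility hν]
    refine integral_nonneg_of_ae ?_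
    filter_upwards [hν] with p hp using hτ.secondPrice_ir hp.1.le v i
  ic v _ i b _ := by
    rw [hτ.randomReserveSPA_utility hν, hτ.randomReserveSPA_utility hν]
    refine integral_mono_ae
      (((hτ.integrable_alloc ν _ i).const_mul _).sub (hτ.integrable_pay hν _ i))
      (((hτ.integrable_alloc ν _ i).const_mul _).sub (hτ.integrable_pay hν _ i)) ?_
    filter_upwards [hν] with p hp using hτ.secondPrice_ic hp.1.le v i b
  ac v _ := by
    calc ∑ i, ∫ p, (secondPrice τ p).alloc v i ∂ν
        = ∫ p, ∑ i, (secondPrice τ p).alloc v i ∂ν :=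
          (integral_finsetSum _ fun i _ => hτ.integrable_alloc ν v i).symm
      _ ≤ ∫ _, (1 : ℝ) ∂ν := by
          refine integral_mono (integrable_finsetSum _ fun i _ => hτ.integrable_alloc ν v i)
            (integrable_const 1) fun p => ?_
          dsimp only
          rw [← hτ.sum_eq_one v]
          refine Finset.sum_le_sum fun i _ => ?_
          simp only [secondPrice]
          split_ifs
          exacts [le_rfl, hτ.nonneg v i]
      _ = 1 := by simp

end IsTieBreaking

/-! ### Regret as an integral over price levels -/

/-- The indicator of the event that no value exceeds `t`. -/
noncomputable def noneAbove {n : ℕ} (t : ℝ) (v : Fin n → ℝ) : ℝ :=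
  ∏ j, if v j ≤ t then 1 else 0

/-- The indicator of the event that at most one value exceeds `t`, written as a polynomial in the
indicators of `v j ≤ t` so that its expectation under a product law is a polynomial in the
distribution function. -/
noncomputable def atMostOneAbove {n : ℕ} (t : ℝ) (v : Fin n → ℝ) : ℝ :=
  ∑ i, (∏ j, if j = i then 1 else if v j ≤ t then 1 else 0) - ((n : ℝ) - 1) * noneAbove t v

theorem noneAbove_eq {n : ℕ} {v : Fin n → ℝ} {i : Fin n} (hi : ∀ j, v j ≤ v i) (t : ℝ) :
    noneAbove t v = if v i ≤ t then 1 else 0 := by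
  unfold noneAbove
  split_ifs with h
  · exact Finset.prod_eq_one fun j _ => if_pos ((hi j).trans h)
  · exact Finset.prod_eq_zero (Finset.mem_univ i) (if_neg h)

theorem atMostOneAbove_eq {n : ℕ} {v : Fin n → ℝ} {i : Fin n} (hi : ∀ j, v j ≤ v i) {t : ℝ}
    (ht : 0 ≤ t) : atMostOneAbove t v = if competingBid v i ≤ t then 1 else 0 := by
  unfold atMostOneAbove
  rw [noneAbove_eq hi]
  by_cases h : competingBid v i ≤ t
  · have hj : ∀ j, j ≠ i → v j ≤ t := fun j hj => (le_competingBid v hj).trans h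
    rw [if_pos h]
    by_cases h1 : v i ≤ t
    · have e : ∀ k : Fin n, (∏ j, if j = k then (1 : ℝ) else if v j ≤ t then 1 else 0) = 1 :=
        fun k => Finset.prod_eq_one fun j _ => by simp [(hi j).trans h1]
      simp [e, h1]
    · rw [if_neg h1, mul_zero, sub_zero, Finset.sum_eq_single i]
      · refine Finset.prod_eq_one fun j _ => ?_
        by_cases hji : j = i
        · simp [hji]
        · simp [hj j hji]
      · intro k _ hk
        exact Finset.prod_eq_zero (Finset.mem_univ i) (by simp [hk.symm, h1])
      · simp
  · have h2 : ∃ k, k ≠ i ∧ t < v k := by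
      by_contra! hc
      exact h (competingBid_le ht hc)
    obtain ⟨k, hki, hk⟩ := h2
    have h1 : t < v i := hk.trans_le (hi k)
    rw [if_neg h, if_neg (not_le.2 h1), mul_zero, sub_zero]
    refine Finset.sum_eq_zero fun l _ => ?_
    rcases eq_or_ne l i with rfl | hl
    · exact Finset.prod_eq_zero (Finset.mem_univ k) (by simp [hki, hk])
    · exact Finset.prod_eq_zero (Finset.mem_univ i) (by simp [hl.symm, h1])

theorem integral_ite_lt {a : ℝ} (ha : a ≤ 1) (f : ℝ → ℝ) :
    ∫ t in Ioc (0 : ℝ) 1, (if a ≤ t then 0 else 1) * f t = ∫ t in Ioc (0 : ℝ) a, f t := by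
  have e : (fun t => (if a ≤ t then 0 else 1) * f t) = (Iio a).indicator f := by
    funext t
    rcases le_or_gt a t with h | h
    · simp [h]
    · simp [h, not_le.2 h]
  have hs : Ioc (0 : ℝ) 1 ∩ Iio a = Ioo 0 a := by
    ext t
    simp only [mem_inter_iff, mem_Ioc, mem_Iio, mem_Ioo]
    exact ⟨fun h => ⟨h.1.1, h.2⟩, fun h => ⟨⟨h.1, h.2.le.trans ha⟩, h.2⟩⟩
  rw [e, setIntegral_indicator measurableSet_Iio, hs]
  exact setIntegral_congr_set Ioo_ae_eq_Ioc

/-- The revenue from a highest bid `a` and a competing bid `c`. Both sides come from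
`p 1(p ≤ a) + (c - p)⁺ = p 1(p ≤ a) + ∫ 1(p ≤ t < c) dt`. -/
theorem integral_price_reserveLaw {m : ℕ} {r : ℝ} (hr : 0 < r) (hr1 : r < 1)
    (he : ReserveEquation (m + 1) r) {a c : ℝ} (hca : c ≤ a) (ha : a ≤ 1) :
    ∫ p, (if p ≤ a then max c p else 0) ∂reserveLaw m r
      = ∫ t in Ioc (0 : ℝ) 1, ((if a ≤ t then 0 else 1) * (t * reserveDensity m r t)
          + (if c ≤ t then 0 else 1) * reserveCDF (m + 1) r t) := by
  have := isProbabilityMeasure_reserveLaw hr hr1 he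
  have hν := ae_mem_reserveLaw m hr
  have h1 : ∀ᵐ p ∂reserveLaw m r, (if p ≤ a then max c p else 0)
      = (Iic a).indicator id p
        + ∫ t in Ioc (0 : ℝ) 1, (if c ≤ t then 0 else 1) * (if p ≤ t then 1 else 0) := by
    filter_upwards [hν] with p hp
    have hp0 := hr.trans hp.1
    have e : (fun t : ℝ => if p ≤ t then (1 : ℝ) else 0) = (Ici p).indicator fun _ => 1 := by
      funext t
      by_cases h : p ≤ t <;> simp [h]
    rw [integral_ite_lt (hca.trans ha), e, setIntegral_indicator measurableSet_Ici,
      show Ioc 0 c ∩ Ici p = Icc p c by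
        ext t
        simp only [mem_inter_iff, mem_Ioc, mem_Ici, mem_Icc]
        constructor
        · rintro ⟨⟨_, h⟩, h'⟩; exact ⟨h', h⟩
        · rintro ⟨h, h'⟩; exact ⟨⟨hp0.trans_le h, h'⟩, h⟩]
    simp only [integral_const, MeasurableSet.univ, measureReal_restrict_apply, univ_inter,
      Real.volume_real_Icc, smul_eq_mul, mul_one]
    by_cases h : p ≤ a
    · simp only [h, if_true, mem_Iic, indicator_of_mem, id]
      rcases le_total c p with h' | h'
      · rw [max_eq_right h', max_eq_right (by linarith)]; ring
      · rw [max_eq_left h', max_eq_left (by linarith)]; ring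
    · simp only [h, if_false, mem_Iic, not_false_eq_true, indicator_of_notMem]
      rw [max_eq_right (by linarith), add_zero]
  have hm : Measurable fun x : ℝ × ℝ =>
      (if c ≤ x.2 then (0 : ℝ) else 1) * (if x.1 ≤ x.2 then 1 else 0) :=
    (Measurable.ite (measurableSet_le measurable_const measurable_snd) measurable_const
      measurable_const).mul (Measurable.ite (measurableSet_le measurable_fst measurable_snd)
      measurable_const measurable_const)
  have hI : Integrable (Function.uncurry fun p t : ℝ =>
      (if c ≤ t then (0 : ℝ) else 1) * (if p ≤ t then 1 else 0))
      ((reserveLaw m r).prod (volume.restrict (Ioc 0 1))) := by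
    refine Integrable.of_bound (C := 1) hm.aestronglyMeasurable (ae_of_all _ fun x => ?_)
    simp only [Function.uncurry]
    split_ifs <;> simp
  have hid : Integrable ((Iic a).indicator id) (reserveLaw m r) := by
    refine Integrable.of_bound (C := 1)
      (measurable_id.indicator measurableSet_Iic).aestronglyMeasurable ?_
    filter_upwards [hν] with p hp
    refine (norm_indicator_le_norm_self _ _).trans ?_
    rw [id, Real.norm_of_nonneg (hr.trans hp.1).le]
    exact hp.2
  have hΦ : IntegrableOn (fun t => (if c ≤ t then 0 else 1) * reserveCDF (m + 1) r t)
      (Ioc (0 : ℝ) 1) := by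
    refine Integrable.of_bound (C := 1) ?_ (ae_of_all _ fun t => ?_)
    · exact ((Measurable.ite measurableSet_Ici measurable_const measurable_const).mul
        (measurable_reserveCDF _ _)).aestronglyMeasurable
    · rw [norm_mul, Real.norm_of_nonneg (reserveCDF_nonneg m hr)]
      have := reserveCDF_le_one hr hr1 he t
      split_ifs <;> simp [this]
  have hφ : IntegrableOn (fun t => (if a ≤ t then 0 else 1) * (t * reserveDensity m r t))
      (Ioc (0 : ℝ) 1) := by
    refine Integrable.of_bound (C := 1) ?_ (ae_of_all _ fun t => ?_)
    · exact ((Measurable.ite measurableSet_Ici measurable_const measurable_const).mul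
        (measurable_id.mul (measurable_reserveDensity _ _))).aestronglyMeasurable
    · have := mul_reserveDensity_mem m hr t
      rw [norm_mul, Real.norm_of_nonneg this.1]
      split_ifs <;> simp [this.2]
  have hJ : Integrable (fun p => ∫ t in Ioc (0 : ℝ) 1,
      (if c ≤ t then (0 : ℝ) else 1) * (if p ≤ t then 1 else 0)) (reserveLaw m r) :=
    hI.integral_prod_left
  rw [integral_congr_ae h1, integral_add hid hJ, integral_add hφ hΦ,
    integral_integral_swap hI]
  congr 1
  · rw [integral_ite_lt ha, reserveLaw, integral_withDensity_eq_integral_toReal_smul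
      (measurable_reserveDensity m r).ennreal_ofReal (by simp)]
    rw [← integral_indicator measurableSet_Ioc]
    refine integral_congr_ae (ae_of_all _ fun t => ?_)
    simp only [ENNReal.toReal_ofReal (reserveDensity_nonneg m hr t), smul_eq_mul]
    by_cases h : t ≤ a
    · by_cases h0 : 0 < t
      · simp [h, h0, mul_comm]
      · have : t ∉ Ioc r 1 := fun h' => h0 (hr.trans h'.1)
        simp [h, h0, reserveDensity, this]
    · simp [h]
  · refine integral_congr_ae (ae_of_all _ fun t => ?_)
    dsimp only
    rw [integral_const_mul]
    congr 1
    have e : (fun p : ℝ => if p ≤ t then (1 : ℝ) else 0) = (Iic t).indicator fun _ => 1 := by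
      funext p
      by_cases h : p ≤ t <;> simp [h]
    rw [e, integral_indicator measurableSet_Iic]
    simp only [integral_const, MeasurableSet.univ, measureReal_restrict_apply, univ_inter,
      smul_eq_mul, mul_one]
    rw [Measure.real, reserveLaw_Iic hr hr1 he, ENNReal.toReal_ofReal (reserveCDF_nonneg m hr)]

theorem iSup_eq_of_forall_le {n : ℕ} {v : Fin n → ℝ} {i : Fin n} (hi : ∀ j, v j ≤ v i) :
    ⨆ j, v j = v i :=
  have : Nonempty (Fin n) := ⟨i⟩
  le_antisymm (ciSup_le hi) (le_ciSup (finite_range v).bddAbove i)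

theorem iSup_eq_integral {n : ℕ} {v : Fin n → ℝ} (hv : ∀ j, v j ∈ Icc (0 : ℝ) 1) {i : Fin n}
    (hi : ∀ j, v j ≤ v i) : ⨆ j, v j = ∫ t in Ioc (0 : ℝ) 1, (1 - noneAbove t v) := by
  have e : ∀ t : ℝ, 1 - noneAbove t v = (if v i ≤ t then 0 else 1) * 1 := by
    intro t
    rw [noneAbove_eq hi]
    split_ifs <;> simp
  simp only [e]
  rw [integral_ite_lt (hv i).2, iSup_eq_of_forall_le hi]
  simp [(hv i).1]

theorem sum_pay_eq_integral {m : ℕ} {r : ℝ} (hr : 0 < r) (hr1 : r < 1)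
    (he : ReserveEquation (m + 1) r) {τ : (Fin (m + 1) → ℝ) → Fin (m + 1) → ℝ}
    (hτ : IsTieBreaking τ) {v : Fin (m + 1) → ℝ} (hv : ∀ j, v j ∈ Icc (0 : ℝ) 1) :
    ∑ i, (randomReserveSPA τ (reserveLaw m r)).pay v i
      = ∫ t in Ioc (0 : ℝ) 1, ((1 - noneAbove t v) * (t * reserveDensity m r t)
          + (1 - atMostOneAbove t v) * reserveCDF (m + 1) r t) := by
  have hone : ∀ i, (randomReserveSPA τ (reserveLaw m r)).pay v i = τ v i *
      ∫ t in Ioc (0 : ℝ) 1, ((1 - noneAbove t v) * (t * reserveDensity m r t)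
          + (1 - atMostOneAbove t v) * reserveCDF (m + 1) r t) := by
    intro i
    have e : (randomReserveSPA τ (reserveLaw m r)).pay v i
        = τ v i * ∫ p, (if p ≤ v i then max (competingBid v i) p else 0) ∂reserveLaw m r := by
      rw [← integral_const_mul]
      refine integral_congr_ae (ae_of_all _ fun p => ?_)
      simp only [secondPrice, mul_ite, mul_zero]
    rw [e]
    rcases eq_or_ne (τ v i) 0 with h0 | h0
    · simp [h0]
    have hi := hτ.highest v i h0
    rw [integral_price_reserveLaw hr hr1 he
      (competingBid_le (hv i).1 fun j _ => hi j) (hv i).2]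
    congr 1
    refine setIntegral_congr_fun measurableSet_Ioc fun t ht => ?_
    rw [noneAbove_eq hi, atMostOneAbove_eq hi ht.1.le]
    congr 2 <;> split_ifs <;> simp
  rw [Finset.sum_congr rfl fun i _ => hone i, ← Finset.sum_mul, hτ.sum_eq_one, one_mul]

/-! ### Expected regret of the random reserve auction -/

theorem measurable_noneAbove {n : ℕ} :
    Measurable fun x : (Fin n → ℝ) × ℝ => noneAbove x.2 x.1 :=
  Finset.measurable_fun_prod _ fun j _ =>
    Measurable.ite (measurableSet_le ((measurable_pi_apply j).comp measurable_fst) measurable_snd)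
      measurable_const measurable_const

theorem measurable_atMostOneAbove {n : ℕ} :
    Measurable fun x : (Fin n → ℝ) × ℝ => atMostOneAbove x.2 x.1 := by
  refine Measurable.sub (Finset.measurable_fun_sum _ fun i _ =>
    Finset.measurable_fun_prod _ fun j _ => ?_) (measurable_noneAbove.const_mul _)
  by_cases h : j = i
  · simp only [h, if_true, measurable_const]
  · simp only [h, if_false]
    exact Measurable.ite (measurableSet_le ((measurable_pi_apply j).comp measurable_fst)
      measurable_snd) measurable_const measurable_const

theorem noneAbove_mem {n : ℕ} (t : ℝ) (v : Fin n → ℝ) : noneAbove t v ∈ Icc (0 : ℝ) 1 := by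
  constructor
  · exact Finset.prod_nonneg fun j _ => by split_ifs <;> norm_num
  · exact Finset.prod_le_one (fun j _ => by split_ifs <;> norm_num)
      fun j _ => by split_ifs <;> norm_num

theorem abs_atMostOneAbove_le {n : ℕ} (t : ℝ) (v : Fin n → ℝ) :
    |atMostOneAbove t v| ≤ n + |(n : ℝ) - 1| := by
  unfold atMostOneAbove
  refine (abs_sub _ _).trans (add_le_add ?_ ?_)
  · refine (Finset.abs_sum_le_sum_abs _ _).trans ?_
    calc _ ≤ ∑ _ : Fin n, (1 : ℝ) := by
          refine Finset.sum_le_sum fun i _ => ?_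
          rw [Finset.abs_prod]
          refine Finset.prod_le_one (fun j _ => abs_nonneg _) fun j _ => ?_
          split_ifs <;> simp
      _ = n := by simp
  · rw [abs_mul, abs_of_nonneg (noneAbove_mem t v).1]
    exact mul_le_of_le_one_right (abs_nonneg _) (noneAbove_mem t v).2

theorem integral_ite_le (F : Measure ℝ) (t : ℝ) :
    ∫ x, (if x ≤ t then (1 : ℝ) else 0) ∂F = F.real (Iic t) := by
  have e : (fun p : ℝ => if p ≤ t then (1 : ℝ) else 0) = (Iic t).indicator fun _ => 1 := by
    funext p
    by_cases h : p ≤ t <;> simp [h]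
  rw [e, integral_indicator measurableSet_Iic]
  simp

theorem integral_noneAbove {n : ℕ} (F : Measure ℝ) [IsProbabilityMeasure F] (t : ℝ) :
    ∫ v, noneAbove t v ∂(Measure.pi fun _ : Fin n => F) = F.real (Iic t) ^ n := by
  unfold noneAbove
  rw [integral_fintype_prod_eq_pow (fun x : ℝ => if x ≤ t then (1 : ℝ) else 0), integral_ite_le,
    Fintype.card_fin]

theorem integrable_noneAbove {n : ℕ} (F : Measure ℝ) [IsProbabilityMeasure F] (t : ℝ) :
    Integrable (fun v => noneAbove t v) (Measure.pi fun _ : Fin n => F) := by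
  have hm : Measurable fun v : Fin n → ℝ => noneAbove t v :=
    measurable_noneAbove.comp measurable_prodMk_right
  refine Integrable.of_bound (C := 1) hm.aestronglyMeasurable (ae_of_all _ fun v => ?_)
  rw [Real.norm_of_nonneg (noneAbove_mem t v).1]
  exact (noneAbove_mem t v).2

theorem integral_atMostOneAbove {n : ℕ} (F : Measure ℝ) [IsProbabilityMeasure F] (t : ℝ) :
    ∫ v, atMostOneAbove t v ∂(Measure.pi fun _ : Fin n => F)
      = n * F.real (Iic t) ^ (n - 1) - ((n : ℝ) - 1) * F.real (Iic t) ^ n := by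
  have hP := integrable_noneAbove (n := n) F t
  have hi : ∀ i : Fin n, ∀ j : Fin n, Measurable fun x : ℝ =>
      if j = i then (1 : ℝ) else if x ≤ t then 1 else 0 := by
    intro i j
    by_cases h : j = i
    · simp only [h, if_true, measurable_const]
    · simp only [h, if_false]
      exact Measurable.ite measurableSet_Iic measurable_const measurable_const
  have hS : ∀ i : Fin n, Integrable
      (fun v : Fin n → ℝ => ∏ j, if j = i then (1 : ℝ) else if v j ≤ t then 1 else 0)
      (Measure.pi fun _ : Fin n => F) := by
    intro i
    refine Integrable.of_bound (C := 1) ?_ (ae_of_all _ fun v => ?_)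
    · exact (Finset.measurable_fun_prod _ fun j _ =>
        (hi i j).comp (measurable_pi_apply j)).aestronglyMeasurable
    · rw [Real.norm_eq_abs, Finset.abs_prod]
      refine Finset.prod_le_one (fun j _ => abs_nonneg _) fun j _ => ?_
      split_ifs <;> simp
  unfold atMostOneAbove
  rw [integral_sub (integrable_finsetSum _ fun i _ => hS i) (hP.const_mul _),
    integral_finsetSum _ fun i _ => hS i, integral_const_mul, integral_noneAbove]
  congr 1
  have e : ∀ i : Fin n, ∫ v : Fin n → ℝ,
      (∏ j, if j = i then (1 : ℝ) else if v j ≤ t then 1 else 0) ∂(Measure.pi fun _ : Fin n => F)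
      = F.real (Iic t) ^ (n - 1) := by
    intro i
    rw [integral_fintype_prod_eq_prod
      (fun j (x : ℝ) => if j = i then (1 : ℝ) else if x ≤ t then 1 else 0)]
    have e2 : ∀ j, ∫ x, (if j = i then (1 : ℝ) else if x ≤ t then 1 else 0) ∂F
        = if j = i then 1 else F.real (Iic t) := by
      intro j
      split_ifs
      · simp
      · exact integral_ite_le F t
    rw [Finset.prod_congr rfl fun j _ => e2 j, Finset.prod_ite, Finset.prod_const_one, one_mul,
      Finset.prod_const, Finset.filter_ne' Finset.univ i, Finset.card_erase_of_mem (Finset.mem_univ i)]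
    simp
  rw [Finset.sum_congr rfl fun i _ => e i]
  simp

theorem integrable_atMostOneAbove {n : ℕ} (F : Measure ℝ) [IsProbabilityMeasure F] (t : ℝ) :
    Integrable (fun v => atMostOneAbove t v) (Measure.pi fun _ : Fin n => F) := by
  have hm : Measurable fun v : Fin n → ℝ => atMostOneAbove t v := by
    have h := (measurable_atMostOneAbove (n := n)).comp (measurable_prodMk_right (y := t))
    exact h
  refine Integrable.of_bound (C := n + |(n : ℝ) - 1|) hm.aestronglyMeasurable
    (ae_of_all _ fun v => ?_)
  rw [Real.norm_eq_abs]
  exact abs_atMostOneAbove_le t v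

theorem integrable_mul_of_bound {n : ℕ} (F : Measure ℝ) [IsProbabilityMeasure F]
    {K : (Fin n → ℝ) × ℝ → ℝ} {a : ℝ → ℝ} {C : ℝ} (hK : Measurable K) (hKC : ∀ x, |K x| ≤ C)
    (ha : Measurable a) (ha1 : ∀ t, |a t| ≤ 1) :
    Integrable (fun x : (Fin n → ℝ) × ℝ => K x * a x.2)
      ((Measure.pi fun _ : Fin n => F).prod (volume.restrict (Ioc 0 1))) := by
  have hm : Measurable fun x : (Fin n → ℝ) × ℝ => K x * a x.2 := hK.mul (ha.comp measurable_snd)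
  refine Integrable.of_bound (C := C) hm.aestronglyMeasurable (ae_of_all _ fun x => ?_)
  rw [norm_mul]
  exact (mul_le_of_le_one_right (norm_nonneg _) (ha1 _)).trans (hKC _)

theorem abs_one_sub_noneAbove_le {n : ℕ} (t : ℝ) (v : Fin n → ℝ) : |1 - noneAbove t v| ≤ 1 := by
  have := noneAbove_mem t v
  rw [abs_le]
  constructor <;> linarith [this.1, this.2]

theorem abs_one_sub_atMostOneAbove_le {n : ℕ} (t : ℝ) (v : Fin n → ℝ) :
    |1 - atMostOneAbove t v| ≤ 1 + (n + |(n : ℝ) - 1|) := by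
  refine (abs_sub _ _).trans ?_
  rw [abs_one]
  linarith [abs_atMostOneAbove_le t v]

theorem integrable_above {n : ℕ} (F : Measure ℝ) [IsProbabilityMeasure F] {a b : ℝ → ℝ}
    (ha : Measurable a) (hb : Measurable b) (ha1 : ∀ t, |a t| ≤ 1) (hb1 : ∀ t, |b t| ≤ 1) :
    Integrable (fun x : (Fin n → ℝ) × ℝ =>
        (1 - noneAbove x.2 x.1) * a x.2 - (1 - atMostOneAbove x.2 x.1) * b x.2)
      ((Measure.pi fun _ : Fin n => F).prod (volume.restrict (Ioc 0 1))) :=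
  (integrable_mul_of_bound F (K := fun x => 1 - noneAbove x.2 x.1)
    (measurable_noneAbove.const_sub 1) (fun x => abs_one_sub_noneAbove_le x.2 x.1) ha ha1).sub
  (integrable_mul_of_bound F (K := fun x => 1 - atMostOneAbove x.2 x.1)
    (measurable_atMostOneAbove.const_sub 1) (fun x => abs_one_sub_atMostOneAbove_le x.2 x.1) hb hb1)

theorem integral_above {n : ℕ} (F : Measure ℝ) [IsProbabilityMeasure F] (a b t : ℝ) :
    ∫ v, ((1 - noneAbove t v) * a - (1 - atMostOneAbove t v) * b) ∂(Measure.pi fun _ : Fin n => F)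
    = (1 - F.real (Iic t) ^ n) * a
        - (1 - (n * F.real (Iic t) ^ (n - 1) - ((n : ℝ) - 1) * F.real (Iic t) ^ n)) * b := by
  have hP := integrable_noneAbove (n := n) F t
  have hS := integrable_atMostOneAbove (n := n) F t
  have hP' : Integrable (fun v => (1 - noneAbove t v) * a) (Measure.pi fun _ : Fin n => F) :=
    ((integrable_const 1).sub hP).mul_const _
  have hS' : Integrable (fun v => (1 - atMostOneAbove t v) * b) (Measure.pi fun _ : Fin n => F) :=
    ((integrable_const 1).sub hS).mul_const _
  rw [integral_sub hP' hS', integral_mul_const, integral_mul_const,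
    integral_sub (integrable_const 1) hP, integral_sub (integrable_const 1) hS,
    integral_noneAbove, integral_atMostOneAbove]
  simp

/-- Expectation under i.i.d. values of an integral over price levels `t`, in terms of the
probabilities that no value, and that at most one value, exceeds `t`. -/
theorem integral_integral_above {n : ℕ} (F : Measure ℝ) [IsProbabilityMeasure F] {a b : ℝ → ℝ}
    (ha : Measurable a) (hb : Measurable b) (ha1 : ∀ t, |a t| ≤ 1) (hb1 : ∀ t, |b t| ≤ 1) :
    ∫ v, (∫ t in Ioc (0 : ℝ) 1, ((1 - noneAbove t v) * a t - (1 - atMostOneAbove t v) * b t))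
      ∂(Measure.pi fun _ : Fin n => F)
    = ∫ t in Ioc (0 : ℝ) 1, ((1 - F.real (Iic t) ^ n) * a t
        - (1 - (n * F.real (Iic t) ^ (n - 1) - ((n : ℝ) - 1) * F.real (Iic t) ^ n)) * b t) := by
  rw [integral_integral_swap (integrable_above F ha hb ha1 hb1)]
  exact integral_congr_ae (ae_of_all _ fun t => integral_above F (a t) (b t) t)

theorem integrableOn_above {n : ℕ} (F : Measure ℝ) [IsProbabilityMeasure F] {a b : ℝ → ℝ}
    (ha : Measurable a) (hb : Measurable b) (ha1 : ∀ t, |a t| ≤ 1) (hb1 : ∀ t, |b t| ≤ 1) :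
    IntegrableOn (fun t => (1 - F.real (Iic t) ^ n) * a t
        - (1 - (n * F.real (Iic t) ^ (n - 1) - ((n : ℝ) - 1) * F.real (Iic t) ^ n)) * b t)
      (Ioc 0 1) :=
  ((integrable_above F ha hb ha1 hb1).integral_prod_right).congr
    (ae_of_all _ fun t => integral_above F (a t) (b t) t)

/-! ### The worst case is the isorevenue distribution -/

theorem bernoulli_pow_le (m : ℕ) {y : ℝ} (hy : 0 ≤ y) :
    ((m : ℝ) + 1) * y ^ m ≤ 1 + m * y ^ (m + 1) := by
  induction m with
  | zero => simp
  | succ m ih =>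
    have h1 : 0 ≤ (1 - y) * (1 - y ^ (m + 1)) := by
      rcases le_total y 1 with h | h
      · exact mul_nonneg (by linarith) (sub_nonneg.2 (pow_le_one₀ hy h))
      · exact mul_nonneg_of_nonpos_of_nonpos (by linarith) (sub_nonpos.2 (one_le_pow₀ h))
    have h2 := mul_le_mul_of_nonneg_right ih hy
    have e1 : ((m : ℝ) + 1) * y ^ m * y = (m + 1) * y ^ (m + 1) := by ring
    have e2 : (1 + (m : ℝ) * y ^ (m + 1)) * y = y + m * y ^ (m + 2) := by ring
    have e3 : (1 - y) * (1 - y ^ (m + 1)) = 1 - y - y ^ (m + 1) + y ^ (m + 2) := by ring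
    push_cast
    rw [e1, e2] at h2
    rw [e3] at h1
    linarith

/-- The largest contribution of the price level `t` to the regret of the random reserve auction,
attained when the distribution function of valuations at `t` is `1 - r / t` (or `0` below `r`). -/
noncomputable def levelRegret (m : ℕ) (r t : ℝ) : ℝ :=
  if t ≤ r then 1
  else 1 - t * reserveDensity m r t - reserveCDF (m + 1) r t + logTail m (1 - r / t)

theorem level_le_levelRegret (m : ℕ) {r t x : ℝ} (hr : 0 < r) (ht : t ≤ 1) (hx : 0 ≤ x) :
    (1 - x ^ (m + 1)) * (1 - t * reserveDensity m r t)
      - (1 - (((m + 1 : ℕ) : ℝ) * x ^ m - (((m + 1 : ℕ) : ℝ) - 1) * x ^ (m + 1)))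
        * reserveCDF (m + 1) r t ≤ levelRegret m r t := by
  unfold levelRegret
  split_ifs with h
  · have h1 : reserveDensity m r t = 0 := if_neg fun h' => not_le.2 h'.1 h
    rw [reserveCDF_of_le _ h, h1]
    have := pow_nonneg hx (m + 1)
    linarith
  · rw [not_le] at h
    have hq := isorevenue_mem hr h
    have ht0 : 0 < t := hr.trans h
    have hL : logTail m (1 - r / t) = (1 - r / t) ^ m * reserveCDF (m + 1) r t := by
      rw [reserveCDF_eq m hr h ht, mul_div_cancel₀ _ (pow_pos hq.1 m).ne']
    have hφ : 1 - t * reserveDensity m r t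
        = m * (r / t / (1 - r / t)) * reserveCDF (m + 1) r t := by
      have e3 : r / (t - r) = r / t / (1 - r / t) := by
        rw [one_sub_div ht0.ne']
        field_simp
      rw [reserveDensity, if_pos ⟨h, ht⟩, mul_div_cancel₀ _ ht0.ne', e3]
      ring
    have hb := bernoulli_pow_le m (div_nonneg hx hq.1.le)
    have hΦ := reserveCDF_nonneg m hr (t := t)
    have e : r / t = 1 - (1 - r / t) := by ring
    rw [hL, hφ]
    rw [e]
    rw [e] at hb
    generalize reserveCDF (m + 1) r t = Φ at hΦ
    obtain ⟨hq0, -⟩ := hq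
    rw [show 1 - (1 - (1 - r / t)) = 1 - r / t by ring] at hb ⊢
    generalize 1 - r / t = q at hq0 hb ⊢
    have h2 := mul_le_mul_of_nonneg_right hb (mul_nonneg hΦ (pow_nonneg hq0.le m))
    rw [div_pow, div_pow] at h2
    have e1 : ((m : ℝ) + 1) * (x ^ m / q ^ m) * (Φ * q ^ m) = (m + 1) * x ^ m * Φ := by
      field_simp
    have e2 : (1 + (m : ℝ) * (x ^ (m + 1) / q ^ (m + 1))) * (Φ * q ^ m)
        = q ^ m * Φ + m * x ^ (m + 1) * Φ / q := by
      field_simp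
      ring
    rw [e1, e2] at h2
    have e3 : (1 - x ^ (m + 1)) * ((m : ℝ) * ((1 - q) / q) * Φ)
        = m * ((1 - q) / q) * Φ - m * x ^ (m + 1) * Φ / q + m * x ^ (m + 1) * Φ := by
      field_simp
      ring
    push_cast
    rw [e3]
    linarith

theorem continuousOn_logTail_isorevenue (m : ℕ) {r : ℝ} (hr : 0 < r) :
    ContinuousOn (fun t => logTail m (1 - r / t)) (Icc r 1) := by
  refine (continuousOn_logTail m).comp (continuousOn_const.sub
    (continuousOn_const.div continuousOn_id fun t ht => (hr.trans_le ht.1).ne')) fun t ht => ?_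
  have := div_pos hr (hr.trans_le ht.1)
  simp only [mem_Iio]
  linarith

theorem continuousOn_isorevenue_pow (m : ℕ) {r : ℝ} (hr : 0 < r) :
    ContinuousOn (fun t : ℝ => (1 - r / t) ^ m) (Icc r 1) :=
  (continuousOn_const.sub
    (continuousOn_const.div continuousOn_id fun _ ht => (hr.trans_le ht.1).ne')).pow m

theorem intervalIntegrable_isorevenue_pow (m : ℕ) {r : ℝ} (hr : 0 < r) (hr1 : r ≤ 1) :
    IntervalIntegrable (fun t : ℝ => (1 - r / t) ^ m) volume r 1 :=
  ContinuousOn.intervalIntegrable (by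
    rw [uIcc_of_le hr1]; exact continuousOn_isorevenue_pow m hr)

/-- The value of the game. -/
noncomputable def saddleValue (m : ℕ) (r : ℝ) : ℝ :=
  (1 - r) ^ m - ∫ v in r..1, (1 - r / v) ^ m

theorem intervalIntegrable_levelRegret {m : ℕ} {r : ℝ} (hr : 0 < r) (hr1 : r < 1) :
    IntervalIntegrable (fun t => 1 - t * reserveDensity m r t - reserveCDF (m + 1) r t
      + logTail m (1 - r / t)) volume r 1 := by
  have h1 : IntervalIntegrable (fun t => t * reserveDensity m r t) volume r 1 :=
    (integrable_reserveDensity m hr).intervalIntegrable.continuousOn_mul continuousOn_id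
  have h2 : IntervalIntegrable (reserveCDF (m + 1) r) volume r 1 :=
    ContinuousOn.intervalIntegrable (by rw [uIcc_of_le hr1.le]; exact continuousOn_reserveCDF hr)
  have h3 : IntervalIntegrable (fun t => logTail m (1 - r / t)) volume r 1 :=
    ContinuousOn.intervalIntegrable (by
      rw [uIcc_of_le hr1.le]; exact continuousOn_logTail_isorevenue m hr)
  exact ((intervalIntegrable_const.sub h1).sub h2).add h3

/-- `t - t Φ(t) + t L(1 - r / t)` is an antiderivative of the level regret plus
`(1 - r / t) ^ m`. -/
theorem integral_levelRegret_above {m : ℕ} {r : ℝ} (hr : 0 < r) (hr1 : r < 1)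
    (he : ReserveEquation (m + 1) r) :
    ∫ t in r..1, (1 - t * reserveDensity m r t - reserveCDF (m + 1) r t + logTail m (1 - r / t))
      = saddleValue m r - r := by
  have hI := (intervalIntegrable_levelRegret (m := m) hr hr1).add
    (intervalIntegrable_isorevenue_pow m hr hr1.le)
  have hd : ∀ t ∈ Ioo r 1, HasDerivAt
      (fun t => t - t * reserveCDF (m + 1) r t + t * logTail m (1 - r / t))
      (1 - t * reserveDensity m r t - reserveCDF (m + 1) r t + logTail m (1 - r / t)
        + (1 - r / t) ^ m) t := by
    intro t ht
    have ht0 : t ≠ 0 := (hr.trans ht.1).ne'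
    refine (((hasDerivAt_id t).sub ((hasDerivAt_id t).mul (hasDerivAt_reserveCDF m hr ht))).add
      ((hasDerivAt_id t).mul (hasDerivAt_logTail_isorevenue m hr ht.1))).congr_deriv ?_
    simp only [id]
    rw [mul_div_cancel₀ _ ht0]
    ring
  have hc : ContinuousOn
      (fun t => t - t * reserveCDF (m + 1) r t + t * logTail m (1 - r / t)) (Icc r 1) :=
    (continuousOn_id.sub (continuousOn_id.mul (continuousOn_reserveCDF hr))).add
      (continuousOn_id.mul (continuousOn_logTail_isorevenue m hr))
  have h := intervalIntegral.integral_eq_sub_of_hasDerivAt_of_le hr1.le hc hd hI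
  rw [intervalIntegral.integral_add (intervalIntegrable_levelRegret hr hr1)
    (intervalIntegrable_isorevenue_pow m hr hr1.le), reserveCDF_one hr hr1 he,
    reserveCDF_of_le _ le_rfl, div_one, (reserveEquation_iff m r).1 he, div_self hr.ne',
    sub_self, logTail_zero_right] at h
  unfold saddleValue
  linarith

theorem integral_levelRegret {m : ℕ} {r : ℝ} (hr : 0 < r) (hr1 : r < 1)
    (he : ReserveEquation (m + 1) r) :
    IntegrableOn (levelRegret m r) (Ioc 0 1) ∧
      ∫ t in Ioc (0 : ℝ) 1, levelRegret m r t = saddleValue m r := by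
  have e1 : EqOn (levelRegret m r) (fun _ => 1) (Ioc 0 r) := fun t ht => if_pos ht.2
  have e2 : EqOn (levelRegret m r) (fun t => 1 - t * reserveDensity m r t
      - reserveCDF (m + 1) r t + logTail m (1 - r / t)) (Ioc r 1) :=
    fun t ht => if_neg (not_le.2 ht.1)
  have hu : Ioc (0 : ℝ) 1 = Ioc 0 r ∪ Ioc r 1 := (Ioc_union_Ioc_eq_Ioc hr.le hr1.le).symm
  have hd : Disjoint (Ioc (0 : ℝ) r) (Ioc r 1) := Ioc_disjoint_Ioc_of_le le_rfl
  have i1 : IntegrableOn (levelRegret m r) (Ioc 0 r) :=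
    (integrableOn_congr_fun e1 measurableSet_Ioc).2 (integrableOn_const (by simp))
  have i2 : IntegrableOn (levelRegret m r) (Ioc r 1) :=
    (integrableOn_congr_fun e2 measurableSet_Ioc).2
      ((intervalIntegrable_iff_integrableOn_Ioc_of_le hr1.le).1 (intervalIntegrable_levelRegret hr hr1))
  refine ⟨hu ▸ i1.union i2, ?_⟩
  rw [hu, setIntegral_union hd measurableSet_Ioc i1 i2, setIntegral_congr_fun measurableSet_Ioc e1,
    setIntegral_congr_fun measurableSet_Ioc e2, ← intervalIntegral.integral_of_le hr1.le,
    integral_levelRegret_above hr hr1 he]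
  simp [hr.le]

theorem ae_mem_Icc_pi {n : ℕ} {F : Measure ℝ} [IsProbabilityMeasure F] (hF : F (Icc 0 1)ᶜ = 0) :
    ∀ᵐ v ∂(Measure.pi fun _ : Fin n => F), ∀ j, v j ∈ Icc (0 : ℝ) 1 := by
  refine ae_all_iff.2 fun j => ?_
  have h : ∀ᵐ x ∂F, x ∈ Icc (0 : ℝ) 1 := by
    rw [ae_iff]
    exact hF
  exact (Measure.tendsto_eval_ae_ae (μ := fun _ : Fin n => F) (i := j)).eventually h

theorem regret_eq_integral {m : ℕ} {r : ℝ} (hr : 0 < r) (hr1 : r < 1)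
    (he : ReserveEquation (m + 1) r) {τ : (Fin (m + 1) → ℝ) → Fin (m + 1) → ℝ}
    (hτ : IsTieBreaking τ) {v : Fin (m + 1) → ℝ} (hv : ∀ j, v j ∈ Icc (0 : ℝ) 1) :
    (⨆ i, v i) - ∑ i, (randomReserveSPA τ (reserveLaw m r)).pay v i
      = ∫ t in Ioc (0 : ℝ) 1, ((1 - noneAbove t v) * (1 - t * reserveDensity m r t)
        - (1 - atMostOneAbove t v) * reserveCDF (m + 1) r t) := by
  obtain ⟨i, hi⟩ := hτ.exists_ne_zero v
  have hmP : Measurable fun t : ℝ => 1 - noneAbove t v :=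
    (measurable_noneAbove.comp measurable_prodMk_left).const_sub 1
  have hmS : Measurable fun t : ℝ => 1 - atMostOneAbove t v :=
    (measurable_atMostOneAbove.comp measurable_prodMk_left).const_sub 1
  have hd : Measurable fun t => t * reserveDensity m r t :=
    measurable_id.mul (measurable_reserveDensity m r)
  have hΦ := measurable_reserveCDF (m + 1) r
  have i1 : IntegrableOn (fun t : ℝ => 1 - noneAbove t v) (Ioc 0 1) :=
    Integrable.of_bound hmP.aestronglyMeasurable 1
      (ae_of_all _ fun t => abs_one_sub_noneAbove_le t v)
  have i2 : IntegrableOn (fun t : ℝ => (1 - noneAbove t v) * (t * reserveDensity m r t))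
      (Ioc 0 1) := by
    refine Integrable.of_bound (hmP.mul hd).aestronglyMeasurable 1 (ae_of_all _ fun t => ?_)
    have h2 := mul_reserveDensity_mem m hr t
    rw [norm_mul, Real.norm_of_nonneg h2.1]
    exact mul_le_one₀ (abs_one_sub_noneAbove_le t v) h2.1 h2.2
  have i3 : IntegrableOn (fun t : ℝ => (1 - atMostOneAbove t v) * reserveCDF (m + 1) r t)
      (Ioc 0 1) := by
    refine Integrable.of_bound (hmS.mul hΦ).aestronglyMeasurable _ (ae_of_all _ fun t =>
      le_trans ?_ (abs_one_sub_atMostOneAbove_le t v))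
    rw [norm_mul, Real.norm_of_nonneg (reserveCDF_nonneg m hr)]
    exact mul_le_of_le_one_right (norm_nonneg _) (reserveCDF_le_one hr hr1 he t)
  have i4 : IntegrableOn (fun t : ℝ => (1 - noneAbove t v) * (t * reserveDensity m r t)
      + (1 - atMostOneAbove t v) * reserveCDF (m + 1) r t) (Ioc 0 1) := i2.add i3
  rw [iSup_eq_integral hv (hτ.highest v i hi), sum_pay_eq_integral hr hr1 he hτ hv,
    ← integral_sub i1 i4]
  refine integral_congr_ae (ae_of_all _ fun t => ?_)
  dsimp only
  ring

/-- Against every i.i.d. law the random reserve auction has at most the regret `saddleValue`. -/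
theorem regret_randomReserveSPA_le {m : ℕ} {r : ℝ} (hr : 0 < r) (hr1 : r < 1)
    (he : ReserveEquation (m + 1) r) {τ : (Fin (m + 1) → ℝ) → Fin (m + 1) → ℝ}
    (hτ : IsTieBreaking τ) {P : Measure (Fin (m + 1) → ℝ)} (hP : P ∈ iidLaws (m + 1)) :
    regret (randomReserveSPA τ (reserveLaw m r)) P ≤ ENNReal.ofReal (saddleValue m r) := by
  obtain ⟨F, hF, hF0, rfl⟩ := hP
  have hν := isProbabilityMeasure_reserveLaw hr hr1 he
  have hν0 : ∀ᵐ p ∂reserveLaw m r, p ∈ Ioc (0 : ℝ) 1 :=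
    (ae_mem_reserveLaw m hr).mono fun p hp => ⟨hr.trans hp.1, hp.2⟩
  have hD := hτ.isDSIC_randomReserveSPA (reserveLaw m r) hν0 (Icc 0 1)
  have ha : Measurable fun t => 1 - t * reserveDensity m r t :=
    (measurable_id.mul (measurable_reserveDensity m r)).const_sub 1
  have ha1 : ∀ t, |1 - t * reserveDensity m r t| ≤ 1 := fun t => by
    have := mul_reserveDensity_mem m hr t
    rw [abs_le]
    constructor <;> linarith [this.1, this.2]
  have hb1 : ∀ t, |reserveCDF (m + 1) r t| ≤ 1 := fun t => by
    rw [abs_of_nonneg (reserveCDF_nonneg m hr)]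
    exact reserveCDF_le_one hr hr1 he t
  have hΦ := measurable_reserveCDF (m + 1) r
  have hI := (integrable_above (n := m + 1) F ha hΦ ha1 hb1).integral_prod_left
  have hE := integral_integral_above (n := m + 1) F ha hΦ ha1 hb1
  have hpt : ∀ᵐ v ∂(Measure.pi fun _ : Fin (m + 1) => F),
      (⨆ i, v i) - ∑ i, (randomReserveSPA τ (reserveLaw m r)).pay v i
      = ∫ t in Ioc (0 : ℝ) 1, ((1 - noneAbove t v) * (1 - t * reserveDensity m r t)
        - (1 - atMostOneAbove t v) * reserveCDF (m + 1) r t) := by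
    filter_upwards [ae_mem_Icc_pi hF0] with v hv using regret_eq_integral hr hr1 he hτ hv
  have hnn : 0 ≤ᵐ[Measure.pi fun _ : Fin (m + 1) => F]
      fun v => (⨆ i, v i) - ∑ i, (randomReserveSPA τ (reserveLaw m r)).pay v i := by
    filter_upwards [ae_mem_Icc_pi hF0] with v hv using hD.sum_pay_le_max subset_rfl v hv
  unfold regret
  rw [← ofReal_integral_eq_lintegral_ofReal ((integrable_congr hpt).2 hI) hnn,
    integral_congr_ae hpt, hE]
  refine ENNReal.ofReal_le_ofReal ?_
  obtain ⟨hlI, hl⟩ := integral_levelRegret hr hr1 he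
  rw [← hl]
  exact setIntegral_mono_on (integrableOn_above F ha hΦ ha1 hb1) hlI measurableSet_Ioc
    fun t ht => level_le_levelRegret m hr ht.2 measureReal_nonneg

/-! ### Revenue bound against the isorevenue distribution -/

/-- If `x` is a subgradient of `u`, then `u` is differentiable with derivative `x` wherever `x` is
continuous. -/
theorem hasDerivAt_of_envelope {x u : ℝ → ℝ}
    (h : ∀ a ∈ Icc (0 : ℝ) 1, ∀ b ∈ Icc (0 : ℝ) 1, u a + x a * (b - a) ≤ u b) {t : ℝ}
    (ht : t ∈ Ioo (0 : ℝ) 1) (hx : ContinuousAt x t) : HasDerivAt u (x t) t := by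
  rw [hasDerivAt_iff_isLittleO, Asymptotics.isLittleO_iff]
  intro c hc
  have h1 : ∀ᶠ s in nhds t, |x s - x t| < c := by
    simpa [Real.dist_eq] using Metric.tendsto_nhds.1 hx c hc
  filter_upwards [h1, Ioo_mem_nhds ht.1 ht.2] with s hs hsm
  have e1 := h t (Ioo_subset_Icc_self ht) s (Ioo_subset_Icc_self hsm)
  have e2 := h s (Ioo_subset_Icc_self hsm) t (Ioo_subset_Icc_self ht)
  rw [smul_eq_mul, Real.norm_eq_abs, Real.norm_eq_abs, abs_of_nonneg (by linarith)]
  calc u s - u t - (s - t) * x t ≤ (x s - x t) * (s - t) := by linarith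
    _ ≤ |x s - x t| * |s - t| := by rw [← abs_mul]; exact le_abs_self _
    _ ≤ c * |s - t| := mul_le_mul_of_nonneg_right hs.le (abs_nonneg _)

/-- Against the isorevenue density the payment `t * x t - u t` is, up to the factor `r`, the
derivative of `u t / t`. -/
theorem integral_payment_isorevenue {x u : ℝ → ℝ} {r : ℝ} (hr : 0 < r) (hr1 : r < 1)
    (hx : ∀ a ∈ Icc (0 : ℝ) 1, x a ∈ Icc (0 : ℝ) 1)
    (h : ∀ a ∈ Icc (0 : ℝ) 1, ∀ b ∈ Icc (0 : ℝ) 1, u a + x a * (b - a) ≤ u b) :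
    ∫ t in r..1, r / t ^ 2 * (t * x t - u t) = r * u 1 - u r := by
  have hmono : MonotoneOn x (Icc 0 1) := by
    intro a ha b hb hab
    rcases hab.eq_or_lt with rfl | hlt
    · exact le_rfl
    · have h1 := h a ha b hb
      have h2 := h b hb a ha
      have h3 : x a * (b - a) ≤ x b * (b - a) := by linarith
      exact le_of_mul_le_mul_right h3 (sub_pos.2 hlt)
  have hlip : LipschitzOnWith 1 u (Icc 0 1) := by
    refine LipschitzOnWith.of_le_add_mul 1 fun a ha b hb => ?_
    have h1 := h a ha b hb
    rw [Real.dist_eq, NNReal.coe_one, one_mul]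
    have h2 : |x a * (b - a)| ≤ |b - a| := by
      rw [abs_mul, abs_of_nonneg (hx a ha).1]
      exact mul_le_of_le_one_left (abs_nonneg _) (hx a ha).2
    rw [abs_sub_comm a b]
    linarith [(abs_le.1 h2).1]
  have hsub : Icc r 1 ⊆ Icc 0 1 := Icc_subset_Icc_left hr.le
  have hne : ∀ t ∈ Icc r 1, t ≠ 0 := fun t ht => (hr.trans_le ht.1).ne'
  have huc : ContinuousOn u (Icc r 1) := hlip.continuousOn.mono hsub
  have hcont : ContinuousOn (fun t => r * u t / t) (Icc r 1) :=
    (huc.const_smul r).div continuousOn_id hne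
  have hint : IntervalIntegrable (fun t => r / t ^ 2 * (t * x t - u t)) volume r 1 := by
    have hxi : IntervalIntegrable x volume r 1 :=
      MonotoneOn.intervalIntegrable (by rw [uIcc_of_le hr1.le]; exact hmono.mono hsub)
    have hui : IntervalIntegrable u volume r 1 :=
      ContinuousOn.intervalIntegrable (by rwa [uIcc_of_le hr1.le])
    refine ((hxi.continuousOn_mul continuousOn_id).sub hui).continuousOn_mul ?_
    rw [uIcc_of_le hr1.le]
    exact continuousOn_const.div (continuousOn_id.pow 2) fun t ht => pow_ne_zero 2 (hne t ht)
  rw [integral_eq_of_hasDerivAt_off_countable_of_le (fun t => r * u t / t) _ hr1.le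
    hmono.countable_not_continuousWithinAt hcont ?_ hint]
  · field_simp
  · intro t ht
    have ht01 : t ∈ Ioo (0 : ℝ) 1 := ⟨hr.trans ht.1.1, ht.1.2⟩
    have hxt : ContinuousAt x t := by
      by_contra hc
      exact ht.2 ⟨Ioo_subset_Icc_self ht01, fun hw =>
        hc (hw.continuousAt (Icc_mem_nhds ht01.1 ht01.2))⟩
    refine ((((hasDerivAt_of_envelope h ht01 hxt).const_mul r).div (hasDerivAt_id t)
      ht01.1.ne')).congr_deriv ?_
    have := ht01.1.ne'
    simp only [id]
    field_simp

theorem measurePreserving_update {n : ℕ} (F : Measure ℝ) [IsProbabilityMeasure F] (i : Fin n) :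
    MeasurePreserving (fun p : (Fin n → ℝ) × ℝ => Function.update p.1 i p.2)
      ((Measure.pi fun _ : Fin n => F).prod F) (Measure.pi fun _ : Fin n => F) := by
  refine ⟨measurable_update', (Measure.pi_eq fun s hs => ?_).symm⟩
  rw [Measure.map_apply measurable_update' (MeasurableSet.univ_pi hs)]
  have e : (fun p : (Fin n → ℝ) × ℝ => Function.update p.1 i p.2) ⁻¹' pi univ s
      = (pi univ (Function.update s i univ)) ×ˢ s i := by
    ext ⟨v, a⟩
    simp only [mem_preimage, mem_pi, mem_univ, true_imp_iff, mem_prod]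
    constructor
    · intro h
      refine ⟨fun j => ?_, by simpa using h i⟩
      rcases eq_or_ne j i with rfl | hj
      · simp
      · simpa [hj] using h j
    · rintro ⟨h, ha⟩ j
      rcases eq_or_ne j i with rfl | hj
      · simpa using ha
      · simpa [hj] using h j
  rw [e, Measure.prod_prod, Measure.pi_pi,
    ← Finset.mul_prod_erase Finset.univ (fun j => F (s j)) (Finset.mem_univ i),
    ← Finset.mul_prod_erase Finset.univ (fun j => F (Function.update s i univ j))
      (Finset.mem_univ i), Function.update_self, measure_univ, one_mul, mul_comm]
  congr 1
  exact Finset.prod_congr rfl fun j hj => by rw [Function.update_of_ne (Finset.ne_of_mem_erase hj)]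

theorem integral_eq_integral_update {n : ℕ} (F : Measure ℝ) [IsProbabilityMeasure F] (i : Fin n)
    {f : (Fin n → ℝ) → ℝ} (hf : Integrable f (Measure.pi fun _ : Fin n => F)) :
    Integrable (fun v => ∫ s, f (Function.update v i s) ∂F) (Measure.pi fun _ : Fin n => F) ∧
    ∫ v, f v ∂(Measure.pi fun _ : Fin n => F)
      = ∫ v, ∫ s, f (Function.update v i s) ∂F ∂(Measure.pi fun _ : Fin n => F) := by
  have hmp := measurePreserving_update F i
  have hI := hmp.integrable_comp_of_integrable hf
  refine ⟨hI.integral_prod_left, ?_⟩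
  have h1 : ∫ v, f v ∂(Measure.pi fun _ : Fin n => F)
      = ∫ p, f (Function.update p.1 i p.2) ∂((Measure.pi fun _ : Fin n => F).prod F) := by
    conv_lhs => rw [← hmp.map_eq]
    exact integral_map hmp.measurable.aemeasurable (by rw [hmp.map_eq]; exact hf.1)
  rw [h1]
  exact integral_prod _ hI

/-- The mechanism with the payments shifted so that a buyer of value `0` gets utility `0`. -/
def Mechanism.normalize {n : ℕ} (m : Mechanism n) : Mechanism n where
  alloc := m.alloc
  pay v i := m.pay v i - m.pay (Function.update v i 0) i

theorem update_mem {n : ℕ} {D : Set ℝ} {v : Fin n → ℝ} (hv : ∀ j, v j ∈ D) (i : Fin n) {b : ℝ}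
    (hb : b ∈ D) (j : Fin n) : Function.update v i b j ∈ D := by
  rcases eq_or_ne j i with rfl | hj
  · simpa using hb
  · simpa [hj] using hv j

namespace IsDSIC

variable {n : ℕ} {D : Set ℝ} {m : Mechanism n}

theorem mono {D' : Set ℝ} (hm : IsDSIC D m) (h : D' ⊆ D) : IsDSIC D' m where
  measurable_alloc := hm.measurable_alloc
  measurable_pay := hm.measurable_pay
  alloc_mem v hv := hm.alloc_mem v fun j => h (hv j)
  ir v hv := hm.ir v fun j => h (hv j)
  ic v hv i b hb := hm.ic v (fun j => h (hv j)) i b (h hb)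
  ac v hv := hm.ac v fun j => h (hv j)

theorem measurable_pay_apply (hm : IsDSIC D m) (i : Fin n) : Measurable fun v => m.pay v i :=
  (measurable_pi_apply i).comp hm.measurable_pay

theorem measurable_alloc_apply (hm : IsDSIC D m) (i : Fin n) : Measurable fun v => m.alloc v i :=
  (measurable_pi_apply i).comp hm.measurable_alloc

theorem normalize (hm : IsDSIC (Icc 0 1) m) : IsDSIC (Icc 0 1) m.normalize where
  measurable_alloc := hm.measurable_alloc
  measurable_pay := measurable_pi_iff.2 fun i => (hm.measurable_pay_apply i).sub
    ((hm.measurable_pay_apply i).comp (measurable_update'.comp measurable_prodMk_right))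
  alloc_mem := hm.alloc_mem
  ir v hv i := by
    have h1 := hm.ic v hv i 0 (by simp)
    have h2 := (hm.alloc_mem _ (update_mem hv i (b := 0) (by simp)) i).1
    have h3 := mul_nonneg (hv i).1 h2
    simp only [Mechanism.normalize]
    linarith
  ic v hv i b hb := by
    have h1 := hm.ic v hv i b hb
    simp only [Mechanism.normalize, Function.update_idem]
    linarith
  ac := hm.ac

theorem pay_le_normalize (hm : IsDSIC (Icc 0 1) m) {v : Fin n → ℝ}
    (hv : ∀ j, v j ∈ Icc (0 : ℝ) 1) (i : Fin n) : m.pay v i ≤ m.normalize.pay v i := by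
  have h := hm.ir _ (update_mem hv i (b := 0) (by simp)) i
  rw [Function.update_self, zero_mul] at h
  simp only [Mechanism.normalize]
  linarith

theorem normalize_pay_mem (hm : IsDSIC (Icc 0 1) m) {v : Fin n → ℝ}
    (hv : ∀ j, v j ∈ Icc (0 : ℝ) 1) (i : Fin n) : m.normalize.pay v i ∈ Icc (0 : ℝ) 1 := by
  constructor
  · have h := hm.ic _ (update_mem hv i (b := 0) (by simp)) i (v i) (hv i)
    rw [Function.update_idem, Function.update_eq_self, Function.update_self] at h
    simp only [Mechanism.normalize]
    linarith
  · have h1 := hm.normalize.ir v hv i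
    have h2 := hm.normalize.alloc_mem v hv i
    have h3 := mul_le_one₀ (hv i).2 h2.1 h2.2
    linarith

/-- Against a buyer with isorevenue distributed value only a sale at value `1` is worth something:
all other virtual values vanish. -/
theorem integral_normalize_pay_update_le (hm : IsDSIC (Icc 0 1) m) {r : ℝ} (hr : 0 < r)
    (hr1 : r < 1) {v : Fin n → ℝ} (hv : ∀ j, v j ∈ Icc (0 : ℝ) 1) (i : Fin n) :
    ∫ s, m.normalize.pay (Function.update v i s) i ∂isorevenueLaw r
      ≤ r * m.alloc (Function.update v i 1) i := by
  have hF := isProbabilityMeasure_isorevenueLaw hr hr1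
  set x : ℝ → ℝ := fun s => m.alloc (Function.update v i s) i with hx
  set u : ℝ → ℝ := fun s => s * x s - m.normalize.pay (Function.update v i s) i with hu
  have hmem : ∀ s ∈ Icc (0 : ℝ) 1, ∀ j, Function.update v i s j ∈ Icc (0 : ℝ) 1 :=
    fun s hs => update_mem hv i hs
  have hus : ∀ s ∈ Icc (0 : ℝ) 1, 0 ≤ u s := by
    intro s hs
    have h := hm.normalize.ir _ (hmem s hs) i
    rwa [Function.update_self] at h
  have henv : ∀ a ∈ Icc (0 : ℝ) 1, ∀ b ∈ Icc (0 : ℝ) 1, u a + x a * (b - a) ≤ u b := by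
    intro a ha b hb
    have h := hm.normalize.ic _ (hmem b hb) i a ha
    rw [Function.update_idem, Function.update_self] at h
    change b * x a - m.normalize.pay (Function.update v i a) i ≤ u b at h
    simp only [hu] at h ⊢
    linarith
  have hp : (fun s => m.normalize.pay (Function.update v i s) i) = fun s => s * x s - u s := by
    funext s
    simp only [hu]
    ring
  have hint : Integrable (fun s => m.normalize.pay (Function.update v i s) i)
      (isorevenueLaw r) := by
    refine Integrable.of_bound (C := 1) ?_ ?_
    · exact ((hm.normalize.measurable_pay_apply i).comp
        (measurable_update v)).aestronglyMeasurable
    · have h0 : ∀ᵐ s ∂isorevenueLaw r, s ∈ Icc (0 : ℝ) 1 := by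
        rw [ae_iff]
        exact isorevenueLaw_compl_Icc hr
      filter_upwards [h0] with s hs
      have h := hm.normalize_pay_mem (hmem s hs) i
      rw [Real.norm_of_nonneg h.1]
      exact h.2
  rw [hp] at hint ⊢
  rw [integral_isorevenueLaw hr hr1.le hint,
    integral_payment_isorevenue hr hr1 (fun a ha => hm.alloc_mem _ (hmem a ha) i) henv]
  have := hus r ⟨hr.le, hr1.le⟩
  change _ ≤ r * x 1
  linarith

theorem integrable_normalize_pay (hm : IsDSIC (Icc 0 1) m) {F : Measure ℝ}
    [IsProbabilityMeasure F] (hF : F (Icc 0 1)ᶜ = 0) (i : Fin n) :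
    Integrable (fun v => m.normalize.pay v i) (Measure.pi fun _ : Fin n => F) := by
  refine Integrable.of_bound (C := 1)
    (hm.normalize.measurable_pay_apply i).aestronglyMeasurable ?_
  filter_upwards [ae_mem_Icc_pi hF] with v hv
  have h := hm.normalize_pay_mem hv i
  rw [Real.norm_of_nonneg h.1]
  exact h.2

theorem integrable_top_alloc (hm : IsDSIC (Icc 0 1) m) {F : Measure ℝ}
    [IsProbabilityMeasure F] (hF : F (Icc 0 1)ᶜ = 0) (i : Fin n) :
    Integrable (fun v => if v i = 1 then m.alloc v i else 0) (Measure.pi fun _ : Fin n => F) := by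
  refine Integrable.of_bound (C := 1) ?_ ?_
  · exact (Measurable.ite (measurable_pi_apply i (measurableSet_singleton 1))
      (hm.measurable_alloc_apply i) measurable_const).aestronglyMeasurable
  · filter_upwards [ae_mem_Icc_pi hF] with v hv
    have h := hm.alloc_mem v hv i
    split_ifs
    · rw [Real.norm_of_nonneg h.1]
      exact h.2
    · simp

theorem integral_normalize_pay_le (hm : IsDSIC (Icc 0 1) m) {r : ℝ} (hr : 0 < r)
    (hr1 : r < 1) (i : Fin n) :
    ∫ v, m.normalize.pay v i ∂(Measure.pi fun _ : Fin n => isorevenueLaw r)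
      ≤ ∫ v, (if v i = 1 then m.alloc v i else 0)
        ∂(Measure.pi fun _ : Fin n => isorevenueLaw r) := by
  have := isProbabilityMeasure_isorevenueLaw hr hr1
  have hF := isorevenueLaw_compl_Icc hr
  obtain ⟨i1, e1⟩ := integral_eq_integral_update (isorevenueLaw r) i
    (hm.integrable_normalize_pay hF i)
  obtain ⟨i2, e2⟩ := integral_eq_integral_update (isorevenueLaw r) i
    (hm.integrable_top_alloc hF i)
  rw [e1, e2]
  refine integral_mono_ae i1 i2 ?_
  filter_upwards [ae_mem_Icc_pi hF] with v hv
  refine (hm.integral_normalize_pay_update_le hr hr1 hv i).trans_eq ?_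
  simp only [Function.update_self]
  have e : (fun s => if s = 1 then m.alloc (Function.update v i s) i else 0)
      = ({1} : Set ℝ).indicator fun _ => m.alloc (Function.update v i 1) i := by
    funext s
    by_cases h : s = 1 <;> simp [h]
  have hint : Integrable (({1} : Set ℝ).indicator fun _ => m.alloc (Function.update v i 1) i)
      (isorevenueLaw r) := (integrable_const _).indicator (measurableSet_singleton 1)
  rw [e, integral_isorevenueLaw hr hr1.le hint]
  have h0 : ∫ t in r..1, r / t ^ 2 *
      ({1} : Set ℝ).indicator (fun _ => m.alloc (Function.update v i 1) i) t = 0 := by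
    rw [intervalIntegral.integral_of_le hr1.le]
    refine integral_eq_zero_of_ae (ae_restrict_of_ae ?_)
    filter_upwards [(compl_mem_ae_iff.2 (measure_singleton (1 : ℝ)) :
      ({1} : Set ℝ)ᶜ ∈ ae volume)] with t ht
    rw [indicator_of_notMem ht, mul_zero]
    rfl
  rw [h0]
  simp

/-- No mechanism earns more than the probability `1 - (1 - r) ^ n` of a value `1`. -/
theorem integral_sum_normalize_pay_le (hm : IsDSIC (Icc 0 1) m) {r : ℝ} (hr : 0 < r)
    (hr1 : r < 1) :
    ∫ v, ∑ i, m.normalize.pay v i ∂(Measure.pi fun _ : Fin n => isorevenueLaw r)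
      ≤ 1 - (1 - r) ^ n := by
  have := isProbabilityMeasure_isorevenueLaw hr hr1
  have hF := isorevenueLaw_compl_Icc hr
  have hg : Integrable (fun s : ℝ => if s = 1 then (0 : ℝ) else 1) (isorevenueLaw r) := by
    refine Integrable.of_bound (C := 1) (Measurable.ite (measurableSet_singleton 1)
      measurable_const measurable_const).aestronglyMeasurable (ae_of_all _ fun s => ?_)
    split_ifs <;> simp
  have hprod : ∫ v : Fin n → ℝ, ∏ j, (if v j = 1 then (0 : ℝ) else 1)
      ∂(Measure.pi fun _ : Fin n => isorevenueLaw r) = (1 - r) ^ n := by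
    rw [integral_fintype_prod_eq_pow (fun s : ℝ => if s = 1 then (0 : ℝ) else 1),
      integral_isorevenueLaw hr hr1.le hg, Fintype.card_fin]
    congr 1
    rw [if_pos rfl, mul_zero, add_zero]
    calc ∫ t in r..1, r / t ^ 2 * (if t = 1 then (0 : ℝ) else 1) = ∫ t in r..1, r / t ^ 2 := by
          rw [intervalIntegral.integral_of_le hr1.le, intervalIntegral.integral_of_le hr1.le]
          refine integral_congr_ae (ae_restrict_of_ae ?_)
          filter_upwards [(compl_mem_ae_iff.2 (measure_singleton (1 : ℝ)) :
            ({1} : Set ℝ)ᶜ ∈ ae volume)] with t ht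
          rw [if_neg (show t ≠ 1 from ht), mul_one]
      _ = 1 - r := by rw [integral_div_sq hr hr1.le, div_one]
  have hpI : Integrable (fun v : Fin n → ℝ => ∏ j, (if v j = 1 then (0 : ℝ) else 1))
      (Measure.pi fun _ : Fin n => isorevenueLaw r) := by
    refine Integrable.of_bound (C := 1) (Finset.measurable_fun_prod _ fun j _ =>
      Measurable.ite (measurable_pi_apply j (measurableSet_singleton 1))
      measurable_const measurable_const).aestronglyMeasurable (ae_of_all _ fun s => ?_)
    rw [Real.norm_eq_abs, Finset.abs_prod]
    refine Finset.prod_le_one (fun j _ => abs_nonneg _) fun j _ => ?_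
    split_ifs <;> simp
  calc ∫ v, ∑ i, m.normalize.pay v i ∂(Measure.pi fun _ : Fin n => isorevenueLaw r)
      = ∑ i, ∫ v, m.normalize.pay v i ∂(Measure.pi fun _ : Fin n => isorevenueLaw r) :=
        integral_finsetSum _ fun i _ => hm.integrable_normalize_pay hF i
    _ ≤ ∑ i, ∫ v, (if v i = 1 then m.alloc v i else 0)
        ∂(Measure.pi fun _ : Fin n => isorevenueLaw r) :=
        Finset.sum_le_sum fun i _ => hm.integral_normalize_pay_le hr hr1 i
    _ = ∫ v, ∑ i, (if v i = 1 then m.alloc v i else 0)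
        ∂(Measure.pi fun _ : Fin n => isorevenueLaw r) :=
        (integral_finsetSum _ fun i _ => hm.integrable_top_alloc hF i).symm
    _ ≤ ∫ v : Fin n → ℝ, (1 - ∏ j, (if v j = 1 then (0 : ℝ) else 1))
        ∂(Measure.pi fun _ : Fin n => isorevenueLaw r) := by
        refine integral_mono_ae (integrable_finsetSum _ fun i _ => hm.integrable_top_alloc hF i)
          ((integrable_const 1).sub hpI) ?_
        filter_upwards [ae_mem_Icc_pi hF] with v hv
        by_cases h : ∃ j, v j = 1
        · obtain ⟨j, hj⟩ := h
          have h0 : ∏ j, (if v j = 1 then (0 : ℝ) else 1) = 0 :=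
            Finset.prod_eq_zero (Finset.mem_univ j) (if_pos hj)
          rw [h0, sub_zero]
          refine (Finset.sum_le_sum fun i _ => ?_).trans (hm.ac v hv)
          split_ifs
          exacts [le_rfl, (hm.alloc_mem v hv i).1]
        · push Not at h
          simp [h]
    _ = 1 - (1 - r) ^ n := by
        rw [integral_sub (integrable_const 1) hpI, hprod]
        simp

end IsDSIC

/-! ### The saddle value -/

theorem saddleValue_nonneg (m : ℕ) {r : ℝ} (hr : 0 < r) (hr1 : r < 1) : 0 ≤ saddleValue m r := by
  have h : ∫ v in r..1, (1 - r / v) ^ m ≤ ∫ _ in r..1, (1 - r) ^ m := by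
    refine intervalIntegral.integral_mono_on hr1.le (intervalIntegrable_isorevenue_pow m hr hr1.le)
      intervalIntegrable_const fun t ht => ?_
    have ht0 : 0 < t := hr.trans_le ht.1
    have h1 : r / t ≤ 1 := (div_le_one ht0).2 ht.1
    refine pow_le_pow_left₀ (by linarith) ?_ m
    rw [sub_le_sub_iff_left, le_div_iff₀ ht0]
    exact mul_le_of_le_one_right hr.le ht.2
  rw [intervalIntegral.integral_const, smul_eq_mul] at h
  have h2 : (1 - r) * (1 - r) ^ m ≤ (1 - r) ^ m :=
    mul_le_of_le_one_left (pow_nonneg (by linarith) m) (by linarith)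
  unfold saddleValue
  linarith

/-- The antiderivative is `r L(1 - r / t)`; its increment over `[r, 1]` is given by the reserve
equation. -/
theorem integral_isorevenue_pow_sub {m : ℕ} {r : ℝ} (hr : 0 < r) (hr1 : r < 1)
    (he : ReserveEquation (m + 1) r) :
    (∫ t in r..1, (1 - r / t) ^ m) - ∫ t in r..1, (1 - r / t) ^ (m + 1) = r * (1 - r) ^ m := by
  have i1 := intervalIntegrable_isorevenue_pow m hr hr1.le
  have i2 := intervalIntegrable_isorevenue_pow (m + 1) hr hr1.le
  rw [← intervalIntegral.integral_sub i1 i2,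
    intervalIntegral.integral_eq_sub_of_hasDerivAt_of_le
      (f := fun t => r * logTail m (1 - r / t)) hr1.le
      (continuousOn_const.mul (continuousOn_logTail_isorevenue m hr)) ?_ (i1.sub i2)]
  · rw [div_one, (reserveEquation_iff m r).1 he, div_self hr.ne', sub_self, logTail_zero_right]
    ring
  · intro t ht
    refine ((hasDerivAt_logTail_isorevenue m hr ht.1).const_mul r).congr_deriv ?_
    ring

theorem integral_iSup_isorevenueLaw {m : ℕ} {r : ℝ} (hr : 0 < r) (hr1 : r < 1)
    (he : ReserveEquation (m + 1) r) :
    Integrable (fun v : Fin (m + 1) → ℝ => ⨆ i, v i)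
      (Measure.pi fun _ : Fin (m + 1) => isorevenueLaw r) ∧
    ∫ v, ⨆ i, v i ∂(Measure.pi fun _ : Fin (m + 1) => isorevenueLaw r)
      = saddleValue m r + (1 - (1 - r) ^ (m + 1)) := by
  have := isProbabilityMeasure_isorevenueLaw hr hr1
  have hF := isorevenueLaw_compl_Icc hr
  have hpt : (fun v : Fin (m + 1) → ℝ => ⨆ i, v i)
      =ᵐ[Measure.pi fun _ : Fin (m + 1) => isorevenueLaw r] fun v => ∫ t in Ioc (0 : ℝ) 1,
        ((1 - noneAbove t v) * 1 - (1 - atMostOneAbove t v) * 0) := by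
    filter_upwards [ae_mem_Icc_pi hF] with v hv
    obtain ⟨i, hi⟩ := Finite.exists_max v
    rw [iSup_eq_integral hv hi]
    simp
  have h1 : ∀ t : ℝ, |(fun _ : ℝ => (1 : ℝ)) t| ≤ 1 := fun _ => by simp
  have h0 : ∀ t : ℝ, |(fun _ : ℝ => (0 : ℝ)) t| ≤ 1 := fun _ => by simp
  have hI := (integrable_above (n := m + 1) (isorevenueLaw r) measurable_const measurable_const
    h1 h0).integral_prod_left
  refine ⟨(integrable_congr hpt).2 hI, ?_⟩
  have hcdf : ∀ t, (isorevenueLaw r).real (Iic t) = isorevenueCDF r t := fun t => by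
    rw [← ProbabilityTheory.cdf_eq_real, cdf_isorevenueLaw hr hr1]
  rw [integral_congr_ae hpt, integral_integral_above (n := m + 1) (isorevenueLaw r)
    measurable_const measurable_const h1 h0]
  simp only [mul_one, mul_zero, sub_zero, hcdf]
  have e1 : EqOn (fun t => 1 - isorevenueCDF r t ^ (m + 1)) (fun _ => 1) (Ioo 0 r) := by
    intro t ht
    simp [isorevenueCDF, ht.2]
  have e2 : EqOn (fun t => 1 - isorevenueCDF r t ^ (m + 1))
      (fun t => 1 - (1 - r / t) ^ (m + 1)) (Ico r 1) := by
    intro t ht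
    simp [isorevenueCDF, not_lt.2 ht.1, ht.2]
  have i0 := intervalIntegrable_isorevenue_pow (m + 1) hr hr1.le
  have hc : IntervalIntegrable (fun t => 1 - (1 - r / t) ^ (m + 1)) volume r 1 :=
    intervalIntegrable_const.sub i0
  have j1 : IntegrableOn (fun t => 1 - isorevenueCDF r t ^ (m + 1)) (Ioo 0 r) :=
    (integrableOn_congr_fun e1 measurableSet_Ioo).2 (integrableOn_const (by simp))
  have j2 : IntegrableOn (fun t => 1 - isorevenueCDF r t ^ (m + 1)) (Ico r 1) :=
    (integrableOn_congr_fun e2 measurableSet_Ico).2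
      ((intervalIntegrable_iff_integrableOn_Ico_of_le hr1.le).1 hc)
  rw [setIntegral_congr_set (Ioo_ae_eq_Ioc (a := (0 : ℝ)) (b := 1)).symm,
    ← Ioo_union_Ico_eq_Ioo hr hr1.le, setIntegral_union
      (disjoint_left.2 fun t h h' => not_lt.2 h'.1 h.2) measurableSet_Ico j1 j2,
    setIntegral_congr_fun measurableSet_Ioo e1, setIntegral_congr_fun measurableSet_Ico e2,
    setIntegral_congr_set (Ico_ae_eq_Ioc (a := r) (b := 1)),
    ← intervalIntegral.integral_of_le hr1.le, intervalIntegral.integral_sub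
      intervalIntegrable_const i0]
  have h := integral_isorevenue_pow_sub hr hr1 he
  have h2 : (1 - r) ^ (m + 1) = (1 - r) ^ m - r * (1 - r) ^ m := by ring
  unfold saddleValue
  rw [h2]
  simp [hr.le]
  linarith

theorem isorevenueLaw_pi_mem_iidLaws (n : ℕ) {r : ℝ} (hr : 0 < r) (hr1 : r < 1) :
    (Measure.pi fun _ : Fin n => isorevenueLaw r) ∈ iidLaws n :=
  ⟨_, isProbabilityMeasure_isorevenueLaw hr hr1, isorevenueLaw_compl_Icc hr, rfl⟩

/-- Against i.i.d. isorevenue values every mechanism has at least the regret `saddleValue`. -/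
theorem IsDSIC.saddleValue_le_regret {m : ℕ} {r : ℝ} (hr : 0 < r) (hr1 : r < 1)
    (he : ReserveEquation (m + 1) r) {D : Set ℝ} (hD : Icc (0 : ℝ) 1 ⊆ D)
    {M : Mechanism (m + 1)} (hM : IsDSIC D M) :
    ENNReal.ofReal (saddleValue m r)
      ≤ regret M (Measure.pi fun _ : Fin (m + 1) => isorevenueLaw r) := by
  have := isProbabilityMeasure_isorevenueLaw hr hr1
  have hF := isorevenueLaw_compl_Icc hr
  have hM' := hM.mono hD
  obtain ⟨hI, hE⟩ := integral_iSup_isorevenueLaw hr hr1 he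
  have hS : Integrable (fun v => ∑ i, M.normalize.pay v i)
      (Measure.pi fun _ : Fin (m + 1) => isorevenueLaw r) :=
    integrable_finsetSum _ fun i _ => hM'.integrable_normalize_pay hF i
  have hnn : 0 ≤ᵐ[Measure.pi fun _ : Fin (m + 1) => isorevenueLaw r]
      fun v => (⨆ i, v i) - ∑ i, M.normalize.pay v i := by
    filter_upwards [ae_mem_Icc_pi hF] with v hv using
      hM'.normalize.sum_pay_le_max subset_rfl v hv
  calc ENNReal.ofReal (saddleValue m r)
      ≤ ENNReal.ofReal (∫ v, ((⨆ i, v i) - ∑ i, M.normalize.pay v i)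
        ∂(Measure.pi fun _ : Fin (m + 1) => isorevenueLaw r)) := by
        refine ENNReal.ofReal_le_ofReal ?_
        rw [integral_sub hI hS, hE]
        linarith [hM'.integral_sum_normalize_pay_le hr hr1]
    _ = ∫⁻ v, ENNReal.ofReal ((⨆ i, v i) - ∑ i, M.normalize.pay v i)
        ∂(Measure.pi fun _ : Fin (m + 1) => isorevenueLaw r) :=
        ofReal_integral_eq_lintegral_ofReal (hI.sub hS) hnn
    _ ≤ regret M (Measure.pi fun _ : Fin (m + 1) => isorevenueLaw r) := by
        refine lintegral_mono_ae ?_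
        filter_upwards [ae_mem_Icc_pi hF] with v hv
        exact ENNReal.ofReal_le_ofReal (sub_le_sub_left
          (Finset.sum_le_sum fun i _ => hM'.pay_le_normalize hv i) _)

/-! ### The saddle point -/

open Classical in
/-- Uniform tie-breaking is a tie-breaking rule. -/
theorem exists_isTieBreaking (m : ℕ) :
    ∃ τ : (Fin (m + 1) → ℝ) → Fin (m + 1) → ℝ, IsTieBreaking τ := by
  set e : Fin (m + 1) → (Fin (m + 1) → ℝ) → ℝ := fun i v => if ∀ j, v j ≤ v i then 1 else 0 with he
  have hme : ∀ i, Measurable (e i) := fun i => by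
    refine Measurable.ite ?_ measurable_const measurable_const
    rw [ofPred_forall]
    exact MeasurableSet.iInter fun j =>
      measurableSet_le (measurable_pi_apply j) (measurable_pi_apply i)
  have he0 : ∀ i v, 0 ≤ e i v := fun i v => by
    simp only [he]
    split_ifs <;> norm_num
  have hpos : ∀ v, 0 < ∑ j, e j v := by
    intro v
    obtain ⟨i, hi⟩ := Finite.exists_max v
    exact Finset.sum_pos' (fun j _ => he0 j v) ⟨i, Finset.mem_univ i, by simp [he, hi]⟩
  refine ⟨fun v i => e i v / ∑ j, e j v, ?_, ?_, ?_, ?_⟩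
  · exact measurable_pi_iff.2 fun i =>
      (hme i).div (Finset.measurable_fun_sum _ fun j _ => hme j)
  · exact fun v i => div_nonneg (he0 i v) (hpos v).le
  · intro v
    rw [← Finset.sum_div, div_self (hpos v).ne']
  · intro v i hi
    by_contra h
    exact hi (by simp [he, h])

theorem theorem1 (n : ℕ) (hn : 1 ≤ n) (D : Set ℝ) (hD : Set.Icc (0 : ℝ) 1 ⊆ D) :
    ∃ r : ℝ,
      -- `r` is the unique root of the equation in `(0, 1 / n)`
      (r ∈ Set.Ioo (0 : ℝ) (1 / (n : ℝ)) ∧ ReserveEquation n r) ∧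
      (∀ s ∈ Set.Ioo (0 : ℝ) (1 / (n : ℝ)), ReserveEquation n s → s = r) ∧
      -- `ν` is the law of the reserve price, `F` the isorevenue distribution
      ∃ ν F : MeasureTheory.Measure ℝ,
        MeasureTheory.IsProbabilityMeasure ν ∧
        (∀ v, ProbabilityTheory.cdf ν v = reserveCDF n r v) ∧
        MeasureTheory.IsProbabilityMeasure F ∧
        (∀ v, ProbabilityTheory.cdf F v = isorevenueCDF r v) ∧
        (MeasureTheory.Measure.pi fun _ : Fin n => F) ∈ iidLaws n ∧
        (∀ τ : (Fin n → ℝ) → Fin n → ℝ, IsTieBreaking τ →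
          -- the auction is DSIC and attains the minimax regret
          IsDSIC D (randomReserveSPA τ ν) ∧
          worstRegret (randomReserveSPA τ ν) = minimaxRegret n D ∧
          -- saddle point
          (∀ P ∈ iidLaws n, regret (randomReserveSPA τ ν) P
            ≤ regret (randomReserveSPA τ ν) (MeasureTheory.Measure.pi fun _ : Fin n => F)) ∧
          (∀ m : Mechanism n, IsDSIC D m →
            regret (randomReserveSPA τ ν) (MeasureTheory.Measure.pi fun _ : Fin n => F)
              ≤ regret m (MeasureTheory.Measure.pi fun _ : Fin n => F))) ∧
        -- value of the minimax regret
        minimaxRegret n D ≠ ⊤ ∧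
        (minimaxRegret n D).toReal =
          (1 - r) ^ (n - 1) - ∫ v in r..1, (1 - r / v) ^ (n - 1) := by
  obtain ⟨m, rfl⟩ : ∃ m, n = m + 1 := ⟨n - 1, by omega⟩
  obtain ⟨r, hr, he⟩ := exists_reserveEquation m
  have hr0 : 0 < r := hr.1
  have hr1 : r < 1 := by
    refine hr.2.trans_le ((div_le_one (by positivity)).2 ?_)
    exact_mod_cast Nat.succ_le_succ (Nat.zero_le m)
  have hν := isProbabilityMeasure_reserveLaw hr0 hr1 he
  have hν0 : ∀ᵐ p ∂reserveLaw m r, p ∈ Ioc (0 : ℝ) 1 :=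
    (ae_mem_reserveLaw m hr0).mono fun p hp => ⟨hr0.trans hp.1, hp.2⟩
  have hF := isorevenueLaw_pi_mem_iidLaws (m + 1) hr0 hr1
  have hlow : ∀ M : Mechanism (m + 1), IsDSIC D M → ENNReal.ofReal (saddleValue m r)
      ≤ regret M (Measure.pi fun _ : Fin (m + 1) => isorevenueLaw r) :=
    fun M hM => hM.saddleValue_le_regret hr0 hr1 he hD
  have hup : ∀ τ : (Fin (m + 1) → ℝ) → Fin (m + 1) → ℝ, IsTieBreaking τ →
      worstRegret (randomReserveSPA τ (reserveLaw m r)) ≤ ENNReal.ofReal (saddleValue m r) :=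
    fun τ hτ => iSup₂_le fun P hP => regret_randomReserveSPA_le hr0 hr1 he hτ hP
  have hmin : minimaxRegret (m + 1) D = ENNReal.ofReal (saddleValue m r) := by
    obtain ⟨τ, hτ⟩ := exists_isTieBreaking m
    refine le_antisymm ?_ (le_iInf₂ fun M hM => (hlow M hM).trans ?_)
    · exact (iInf₂_le _ (hτ.isDSIC_randomReserveSPA _ hν0 D)).trans (hup τ hτ)
    · exact le_iSup₂ (f := fun P (_ : P ∈ iidLaws (m + 1)) => regret M P) _ hF
  refine ⟨r, ⟨hr, he⟩, fun s hs hes => reserveEquation_unique m hr hs he hes, reserveLaw m r,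
    isorevenueLaw r, hν, cdf_reserveLaw hr0 hr1 he, isProbabilityMeasure_isorevenueLaw hr0 hr1,
    cdf_isorevenueLaw hr0 hr1, hF, fun τ hτ => ?_, ?_, ?_⟩
  · have hD' := hτ.isDSIC_randomReserveSPA (reserveLaw m r) hν0 D
    refine ⟨hD', ?_, fun P hP => ?_, fun M hM => ?_⟩
    · rw [hmin]
      exact le_antisymm (hup τ hτ) ((hlow _ hD').trans
        (le_iSup₂ (f := fun P (_ : P ∈ iidLaws (m + 1)) => regret _ P) _ hF))
    · exact (regret_randomReserveSPA_le hr0 hr1 he hτ hP).trans (hlow _ hD')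
    · exact (regret_randomReserveSPA_le hr0 hr1 he hτ hF).trans (hlow M hM)
  · rw [hmin]
    exact ENNReal.ofReal_ne_top
  · rw [hmin, ENNReal.toReal_ofReal (saddleValue_nonneg m hr0 hr1), Nat.add_sub_cancel]
    rfl
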